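/- Let $A$ be a finite-dimensional algebra over a field $K$; modules are finitely generated right $A$-modules, and $D=\mathrm{Hom}_K(-,K)$. The dominant dimension of a module $M$ with minimal injective resolution $0\to M\to I_0\to I_1\to\cdots$ is $\sup\{n : I_0,\dots,I_{n-1}\text{ are projective}\}\in\mathbb N\cup\{\infty\}$, and the codominant dimension of $M$ is the dominant dimension of the left module $D(M)$. Assume that $A$ is Auslander–Gorenstein of Gorenstein dimension $r$: the left and the right injective dimension of $A$ are both equal to $r$, and $r\ge 2$ is also the dominant dimension of $A_A$. Let $0\le i\le r$ and let $T$ be a basic module (no direct summand $N\oplus N$ with $N$ indecomposable) of projective dimension $i$ and injective dimension $r-i$ that is tilting and cotilting: $\mathrm{Ext}^n(T,T)=0$ for all $n\ge1$, the projective and injective dimensions of $T$ are finite, and there are exact sequences $0\to A\to T_0\to\cdots\to T_m\to 0$ and $0\to T'_{m'}\to\cdots\to T'_0\to D(A)\to 0$ with all terms $T_j,T'_j$ in $\mathrm{add}(T)$. For a class $\mathcal C$ of modules let ${}^\perp\mathcal C=\{X:\mathrm{Ext}^n(X,Y)=0\ \forall Y\in\mathcal C,\ n\ge1\}$, $\mathcal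 C^\perp=\{Y:\mathrm{Ext}^n(X,Y)=0\ \forall X\in\mathcal C,\ n\ge1\}$, and ${}^\perp T={}^\perp\mathrm{add}(T)$, $T^\perp=\mathrm{add}(T)^\perp$. Let $\underline{\mathrm{add}(T)}$ (resp. $\overline{\mathrm{add}(T)}$) be the class of modules $M$ with an exact sequence $0\to M\to C_0\to\cdots\to C_n\to0$ (resp. $0\to C_n\to\cdots\to C_0\to M\to0$) for some $n\geq 0$, all $C_j\in\mathrm{add}(T)$. Let $\mathrm{Proj}_m$, $\mathrm{Inj}_m$, $\mathrm{GProj}_m$, $\mathrm{GInj}_m$ be the classes of modules of projective, injective, Gorenstein projective, Gorenstein injective dimension at most $m$, and $\mathrm{Dom}_m$, $\mathrm{Codom}_m$ the classes of modules of dominant, codominant dimension at least $m$. Then $${}^\perp T=\mathrm{GProj}_i=\mathrm{Dom}_{r-i},\qquad \underline{\mathrm{add}(T)}={}^\perp(T^\perp)=\mathrm{Proj}_i,$$ $$\overline{\mathrm{add}(T)}=({}^\perp T)^\perp=\mathrm{Inj}_{r-i},\qquad T^\perp=\mathrm{GInj}_{r-i}=\mathrm{Codom}_i .$$ -/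

import Mathlib

open CategoryTheory CategoryTheory.Limits CategoryTheory.Abelian MulOpposite

universe u

noncomputable section

namespace RepTheory

/-! Left modules over a ring `R` are objects of `ModuleCat R`; right modules over `A` are objects of
`ModuleCat Aᵐᵒᵖ`. Full subcategories of the category of finitely generated modules are given as
properties of objects of `ModuleCat R` that include finite generation. -/

section General

variable {R : Type u} [Ring R]

/-- `add(T)`: the direct summands of the finite direct sums `T ⊕ ⋯ ⊕ T`. -/
def addClosure (T : ModuleCat.{u} R) : ObjectProperty (ModuleCat.{u} R) := fun M =>
  ∃ n : ℕ, Nonempty (Retract M (ModuleCat.of R (Fin n → T)))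

/-- `⊥C`: the finitely generated `X` with `Ext^n(X, Y) = 0` for all `Y` in `C` and all `n ≥ 1`. -/
def leftPerp (C : ObjectProperty (ModuleCat.{u} R)) : ObjectProperty (ModuleCat.{u} R) := fun X =>
  Module.Finite R X ∧ ∀ Y, C Y → ∀ n : ℕ, 1 ≤ n → Subsingleton (Ext.{u} X Y n)

/-- `C⊥`: the finitely generated `Y` with `Ext^n(X, Y) = 0` for all `X` in `C` and all `n ≥ 1`. -/
def rightPerp (C : ObjectProperty (ModuleCat.{u} R)) : ObjectProperty (ModuleCat.{u} R) := fun Y =>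
  Module.Finite R Y ∧ ∀ X, C X → ∀ n : ℕ, 1 ≤ n → Subsingleton (Ext.{u} X Y n)

/-- There is an exact sequence `0 → C_n → ⋯ → C_1 → C_0 → M → 0` with all `C_j` in `C`
(split into short exact sequences). -/
def HasResolution (C : ObjectProperty (ModuleCat.{u} R)) : ℕ → ModuleCat.{u} R → Prop
  | 0, M => ∃ X, C X ∧ Nonempty (X ≅ M)
  | n + 1, M => ∃ (N X : ModuleCat.{u} R) (f : N ⟶ X) (g : X ⟶ M) (w : f ≫ g = 0),
      (ShortComplex.mk f g w).ShortExact ∧ C X ∧ HasResolution C n N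

/-- There is an exact sequence `0 → M → C_0 → C_1 → ⋯ → C_n → 0` with all `C_j` in `C`
(split into short exact sequences). -/
def HasCoresolution (C : ObjectProperty (ModuleCat.{u} R)) : ℕ → ModuleCat.{u} R → Prop
  | 0, M => ∃ X, C X ∧ Nonempty (M ≅ X)
  | n + 1, M => ∃ (X N : ModuleCat.{u} R) (f : M ⟶ X) (g : X ⟶ N) (w : f ≫ g = 0),
      (ShortComplex.mk f g w).ShortExact ∧ C X ∧ HasCoresolution C n N

/-- The modules with a finite resolution by objects of `C`. -/
def finitelyResolved (C : ObjectProperty (ModuleCat.{u} R)) : ObjectProperty (ModuleCat.{u} R) :=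
  fun M => Module.Finite R M ∧ ∃ n, HasResolution C n M

/-- The modules with a finite coresolution by objects of `C`. -/
def finitelyCoresolved (C : ObjectProperty (ModuleCat.{u} R)) : ObjectProperty (ModuleCat.{u} R) :=
  fun M => Module.Finite R M ∧ ∃ n, HasCoresolution C n M

/-- `Proj_m`: finitely generated modules of projective dimension at most `m`. -/
def projLE (m : ℕ) : ObjectProperty (ModuleCat.{u} R) := fun M =>
  Module.Finite R M ∧ projectiveDimension M ≤ (m : WithBot ℕ∞)

/-- `Inj_m`: finitely generated modules of injective dimension at most `m`. -/
def injLE (m : ℕ) : ObjectProperty (ModuleCat.{u} R) := fun M =>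
  Module.Finite R M ∧ injectiveDimension M ≤ (m : WithBot ℕ∞)

/-- Gorenstein projective modules: cocycle modules of exact complexes of finitely generated
projectives that stay exact under `Hom(-, Q)` for every finitely generated projective `Q`. -/
def gorensteinProjective : ObjectProperty (ModuleCat.{u} R) := fun M =>
  ∃ P : CochainComplex (ModuleCat.{u} R) ℤ,
    (∀ n, Projective (P.X n) ∧ Module.Finite R (P.X n)) ∧
    P.Acyclic ∧
    (∀ Q : ModuleCat.{u} R, Projective Q → Module.Finite R Q →
      ∀ (n : ℤ) (f : P.X n ⟶ Q), P.d (n - 1) n ≫ f = 0 →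
        ∃ g : P.X (n + 1) ⟶ Q, P.d n (n + 1) ≫ g = f) ∧
    Nonempty (M ≅ P.cycles 0)

/-- Gorenstein injective modules: cocycle modules of exact complexes of finitely generated
injectives that stay exact under `Hom(E, -)` for every finitely generated injective `E`. -/
def gorensteinInjective : ObjectProperty (ModuleCat.{u} R) := fun M =>
  ∃ I : CochainComplex (ModuleCat.{u} R) ℤ,
    (∀ n, Injective (I.X n) ∧ Module.Finite R (I.X n)) ∧
    I.Acyclic ∧
    (∀ E : ModuleCat.{u} R, Injective E → Module.Finite R E →
      ∀ (n : ℤ) (f : E ⟶ I.X n), f ≫ I.d n (n + 1) = 0 →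
        ∃ g : E ⟶ I.X (n - 1), g ≫ I.d (n - 1) n = f) ∧
    Nonempty (M ≅ I.cycles 0)

/-- The Gorenstein projective dimension (`⊤` if there is no finite resolution). -/
def gorensteinProjectiveDimension (M : ModuleCat.{u} R) : ℕ∞ :=
  sInf {n : ℕ∞ | ∃ k : ℕ, n = (k : ℕ∞) ∧ HasResolution gorensteinProjective k M}

/-- The Gorenstein injective dimension (`⊤` if there is no finite coresolution). -/
def gorensteinInjectiveDimension (M : ModuleCat.{u} R) : ℕ∞ :=
  sInf {n : ℕ∞ | ∃ k : ℕ, n = (k : ℕ∞) ∧ HasCoresolution gorensteinInjective k M}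

/-- `GProj_m`. -/
def gprojLE (m : ℕ) : ObjectProperty (ModuleCat.{u} R) := fun M =>
  Module.Finite R M ∧ gorensteinProjectiveDimension M ≤ (m : ℕ∞)

/-- `GInj_m`. -/
def ginjLE (m : ℕ) : ObjectProperty (ModuleCat.{u} R) := fun M =>
  Module.Finite R M ∧ gorensteinInjectiveDimension M ≤ (m : ℕ∞)

/-- A submodule is essential if it meets every nonzero submodule nontrivially. -/
def IsEssentialSubmodule {M : Type u} [AddCommGroup M] [Module R M] (N : Submodule R M) : Prop :=
  ∀ L : Submodule R M, L ≠ ⊥ → N ⊓ L ≠ ⊥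

/-- An injective resolution `0 → M → I_0 → I_1 → ⋯` is minimal if each `I_n` is an injective
envelope of `ker(I_n → I_{n+1})` (which is the image of the previous map). -/
def IsMinimalInjectiveResolution {M : ModuleCat.{u} R} (I : InjectiveResolution M) : Prop :=
  ∀ n : ℕ, IsEssentialSubmodule (LinearMap.ker (I.cocomplex.d n (n + 1)).hom)

/-- The dominant dimension: the supremum of the `n` such that the first `n` terms
`I_0, …, I_{n-1}` of a minimal injective resolution of `M` are projective. -/
def dominantDimension (M : ModuleCat.{u} R) : ℕ∞ :=
  sSup {n : ℕ∞ | ∃ I : InjectiveResolution M, IsMinimalInjectiveResolution I ∧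
    ∀ j : ℕ, (j : ℕ∞) < n → Projective (I.cocomplex.X j)}

/-- `Dom_m`: finitely generated modules of dominant dimension at least `m`. -/
def domGE (m : ℕ) : ObjectProperty (ModuleCat.{u} R) := fun M =>
  Module.Finite R M ∧ (m : ℕ∞) ≤ dominantDimension M

/-- A module is basic if it has no direct summand `N ⊕ N` with `N` indecomposable. -/
def IsBasic (T : ModuleCat.{u} R) : Prop :=
  ∀ N : ModuleCat.{u} R, Indecomposable N → IsEmpty (Retract (N ⊞ N) T)

/-- A tilting module of arbitrary finite projective dimension. -/
structure IsTilting (T : ModuleCat.{u} R) : Prop where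
  finite : Module.Finite R T
  projectiveDimension_ne_top : projectiveDimension T ≠ ⊤
  ext_self : ∀ n : ℕ, 1 ≤ n → Subsingleton (Ext.{u} T T n)
  coresolution : ∃ n, HasCoresolution (addClosure T) n (ModuleCat.of R R)

end General

section Duality

variable (K : Type u) {A : Type u} [Field K] [Ring A] [Algebra K A]

open scoped ModuleCat

/-- The left `A`-module structure `(a • f)(m) = f(m a)` on `Hom_K(M, K)` for a right module `M`. -/
abbrev dualLeftModule (M : ModuleCat.{u} Aᵐᵒᵖ) : Module A (Module.Dual K M) where
  smul a f := f ∘ₗ Module.toModuleEnd K M (op a)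
  one_smul f := by ext m; exact congrArg f (one_smul Aᵐᵒᵖ m)
  mul_smul a b f := by ext m; exact congrArg f (mul_smul (op b) (op a) m)
  smul_zero a := rfl
  smul_add a f g := rfl
  add_smul a b f := by
    ext m; exact (congrArg f (add_smul (op a) (op b) m)).trans (map_add f _ _)
  zero_smul f := by ext m; exact (congrArg f (zero_smul Aᵐᵒᵖ m)).trans (map_zero f)

/-- `D(M) = Hom_K(M, K)` as a left module, for a right module `M`. -/
def dualLeft (M : ModuleCat.{u} Aᵐᵒᵖ) : ModuleCat.{u} A :=
  letI := dualLeftModule K M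
  ModuleCat.of A (Module.Dual K M)

/-- The right `A`-module structure `(f • a)(m) = f(a m)` on `Hom_K(M, K)` for a left module `M`. -/
abbrev dualRightModule (M : ModuleCat.{u} A) : Module Aᵐᵒᵖ (Module.Dual K M) where
  smul a f := f ∘ₗ Module.toModuleEnd K M (unop a)
  one_smul f := by ext m; exact congrArg f (one_smul A m)
  mul_smul a b f := by ext m; exact congrArg f (mul_smul (unop b) (unop a) m)
  smul_zero a := rfl
  smul_add a f g := rfl
  add_smul a b f := by
    ext m; exact (congrArg f (add_smul (unop a) (unop b) m)).trans (map_add f _ _)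
  zero_smul f := by ext m; exact (congrArg f (zero_smul A m)).trans (map_zero f)

/-- `D(M) = Hom_K(M, K)` as a right module, for a left module `M`. -/
def dualRight (M : ModuleCat.{u} A) : ModuleCat.{u} Aᵐᵒᵖ :=
  letI := dualRightModule K M
  ModuleCat.of Aᵐᵒᵖ (Module.Dual K M)

/-- The codominant dimension of a right module `M` is the dominant dimension of `D(M)`. -/
def codominantDimension (M : ModuleCat.{u} Aᵐᵒᵖ) : ℕ∞ :=
  dominantDimension (dualLeft K M)

/-- `Codom_m`: finitely generated right modules of codominant dimension at least `m`. -/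
def codomGE (m : ℕ) : ObjectProperty (ModuleCat.{u} Aᵐᵒᵖ) := fun M =>
  Module.Finite Aᵐᵒᵖ M ∧ (m : ℕ∞) ≤ codominantDimension K M

/-- A cotilting right module of arbitrary finite injective dimension. The resolved module is the
injective cogenerator `D(A)`, the dual of the regular left module. -/
structure IsCotilting (T : ModuleCat.{u} Aᵐᵒᵖ) : Prop where
  finite : Module.Finite Aᵐᵒᵖ T
  injectiveDimension_ne_top : injectiveDimension T ≠ ⊤
  ext_self : ∀ n : ℕ, 1 ≤ n → Subsingleton (Ext.{u} T T n)
  resolution : ∃ n, HasResolution (addClosure T) n (dualRight K (ModuleCat.of A A))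

/-- `A` is Auslander–Gorenstein of Gorenstein dimension `r`: the right and left regular modules
have injective dimension `r`, and `r ≥ 2` is the dominant dimension of the right regular module. -/
structure IsAuslanderGorenstein (A : Type u) [Ring A] (r : ℕ) : Prop where
  injectiveDimension_right : injectiveDimension (ModuleCat.of Aᵐᵒᵖ Aᵐᵒᵖ) = (r : WithBot ℕ∞)
  injectiveDimension_left : injectiveDimension (ModuleCat.of A A) = (r : WithBot ℕ∞)
  dominantDimension_eq : dominantDimension (ModuleCat.of Aᵐᵒᵖ Aᵐᵒᵖ) = (r : ℕ∞)
  two_le : 2 ≤ r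

end Duality

end RepTheory

end

/-! Both outer chains of equalities are proved by running around a circle of inclusions.

For the first, let `X` be in `⊥T`. Since `T` is tilting of projective dimension `i`, the regular
module has an `add(T)`-coresolution of length `i`, so `Ext^n(X, A) = 0` for `n > i`, and the `i`-th
syzygy of `X` lies in `⊥A`. Finite injective dimension of `A` on the left gives `D(A)` a finite
projective resolution, so `A` is itself cotilting; hence modules in `⊥A` embed in free modules with
cokernel again in `⊥A`, and are Gorenstein projective. Thus `⊥T ⊆ GProj_i`.

Next, dominant dimension is read off from Ext: for finitely generated `M`, `M` is in `Dom_m` exactly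
when `Ext^j(Z, M) = 0` for all `j < m` and all finitely generated `Z` without nonzero maps to
projective-injectives (the torsion modules). Dominant dimension `r` gives `A` this vanishing for `j
< r`. A Gorenstein projective module inherits it, being a syzygy of arbitrarily high order, and each
step of a Gorenstein projective resolution costs one degree. So `GProj_i ⊆ Dom_{r-i}`.

Finally, shifting along `r - i` projective-injective terms moves `Ext^n(X, T)`, `n ≥ 1`, to a degree
above `r - i`, where it vanishes because `T` has injective dimension `r - i`. So `Dom_{r-i} ⊆ ⊥T`.

The circle for `T⊥` is dual, but the dominant dimension is assumed on one side only, so it needs the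
codominant dimension of `D(A)` to be at least `r`. This is `extZero_cogenerator_of_isRightTorsion`,
deduced from the injective coresolution of `A` and the projective resolution of `D(A)`.

The descriptions of `⊥(T⊥)` and `(⊥T)⊥` by finite `add(T)`-(co)resolutions are Auslander–Reiten type
approximation arguments. Modules in `⊥(T⊥)` have projective dimension at most `i` by dimension
shifting. Conversely, modules in `T⊥` have projective-injective presentations of length `i`, by the
second circle, and shifting along these puts `Proj_i` inside `⊥(T⊥)`. The injective statement is
dual. -/

noncomputable section

namespace RepTheory

/-! ### Short exact sequences -/

section ShortExact

variable {C : Type*} [Category C] [Abelian C]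

variable {X Y Z : C} {f : X ⟶ Y} {g : Y ⟶ Z}

/-- `0 → X → Y → Z → 0` is a short exact sequence. -/
def IsSES (f : X ⟶ Y) (g : Y ⟶ Z) : Prop := ∃ w : f ≫ g = 0, (ShortComplex.mk f g w).ShortExact

theorem IsSES.mono (h : IsSES f g) : Mono f := h.choose_spec.mono_f

theorem IsSES.epi (h : IsSES f g) : Epi g := h.choose_spec.epi_g

theorem IsSES.of_mono (f : X ⟶ Y) [Mono f] : IsSES f (cokernel.π f) :=
  ⟨cokernel.condition f, { exact := ShortComplex.exact_cokernel f }⟩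

theorem IsSES.of_epi (g : Y ⟶ Z) [Epi g] : IsSES (kernel.ι g) g :=
  ⟨kernel.condition g, { exact := ShortComplex.exact_kernel g }⟩

theorem IsSES.lift (h : IsSES f g) {W : C} (k : W ⟶ Y) (hk : k ≫ g = 0) :
    ∃ l : W ⟶ X, l ≫ f = k := by
  obtain ⟨w, hS⟩ := h
  have := hS.mono_f
  exact ⟨hS.exact.lift k hk, hS.exact.lift_f k hk⟩

theorem IsSES.desc (h : IsSES f g) {W : C} (k : Y ⟶ W) (hk : f ≫ k = 0) :
    ∃ l : Z ⟶ W, g ≫ l = k := by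
  obtain ⟨w, hS⟩ := h
  have := hS.epi_g
  exact ⟨hS.exact.desc k hk, hS.exact.g_desc k hk⟩

end ShortExact

/-! ### Vanishing of Ext and the long exact sequences -/

section ExtVanishing

variable {C : Type*} [Category C] [Abelian C] [HasExt.{u} C]

/-- `Ext^n(X, Y) = 0`. -/
abbrev ExtZero (X Y : C) (n : ℕ) : Prop := Subsingleton (Ext.{u} X Y n)

theorem extZero_of_forall {X Y : C} {n : ℕ} (h : ∀ e : Ext.{u} X Y n, e = 0) : ExtZero X Y n :=
  ⟨fun a b => (h a).trans (h b).symm⟩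

theorem extZero_zero_iff {X Y : C} : ExtZero.{u} X Y 0 ↔ ∀ f : X ⟶ Y, f = 0 := by
  refine ⟨fun h f => (Ext.mk₀_eq_zero_iff f).1 (Subsingleton.elim _ _), fun h => ?_⟩
  refine extZero_of_forall fun e => ?_
  rw [← Ext.mk₀_homEquiv₀_apply e, h (Ext.homEquiv₀ e), Ext.mk₀_zero]

theorem ExtZero.of_projective (P Y : C) [Projective P] (n : ℕ) : ExtZero.{u} P Y (n + 1) :=
  extZero_of_forall Ext.eq_zero_of_projective

theorem ExtZero.of_injective (X I : C) [Injective I] (n : ℕ) : ExtZero.{u} X I (n + 1) :=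
  extZero_of_forall Ext.eq_zero_of_injective

theorem ExtZero.retract_left {X X' Y : C} {n : ℕ} (h : ExtZero.{u} X Y n) (r : Retract X' X) :
    ExtZero X' Y n := by
  refine extZero_of_forall fun e => ?_
  have h1 : (Ext.mk₀ r.r).comp e (zero_add n) = 0 := Subsingleton.elim _ _
  have h2 := Ext.mk₀_comp_mk₀_assoc r.i r.r e
  rw [h1, Ext.comp_zero, r.retract, Ext.mk₀_id_comp] at h2
  exact h2.symm

theorem ExtZero.retract_right {X Y Y' : C} {n : ℕ} (h : ExtZero.{u} X Y n) (r : Retract Y' Y) :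
    ExtZero X Y' n := by
  refine extZero_of_forall fun e => ?_
  have h1 : e.comp (Ext.mk₀ r.i) (add_zero n) = 0 := Subsingleton.elim _ _
  have h2 : (e.comp (Ext.mk₀ r.i) (add_zero n)).comp (Ext.mk₀ r.r) (add_zero n) = e := by
    rw [Ext.comp_assoc_of_third_deg_zero, Ext.mk₀_comp_mk₀, r.retract, Ext.comp_mk₀_id]
  rw [← h2, h1, Ext.zero_comp]

variable {X Y Z : C} {f : X ⟶ Y} {g : Y ⟶ Z}

section Covariant

variable (W : C)

theorem IsSES.extZero_right (h : IsSES f g) {n : ℕ} (h2 : ExtZero.{u} W Y n)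
    (h1 : ExtZero.{u} W X (n + 1)) : ExtZero W Z n := by
  obtain ⟨w, hS⟩ := h
  refine extZero_of_forall fun e => ?_
  obtain ⟨e', rfl⟩ := Ext.covariant_sequence_exact₃ W hS e rfl
    (Subsingleton.elim (α := Ext W X (n + 1)) _ _)
  rw [Subsingleton.elim (α := Ext W Y n) e' 0, Ext.zero_comp]

theorem IsSES.extZero_left (h : IsSES f g) {n : ℕ} (h3 : ExtZero.{u} W Z n)
    (h2 : ExtZero.{u} W Y (n + 1)) : ExtZero W X (n + 1) := by
  obtain ⟨w, hS⟩ := h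
  refine extZero_of_forall fun e => ?_
  obtain ⟨e', rfl⟩ := Ext.covariant_sequence_exact₁ W hS e
    (Subsingleton.elim (α := Ext W Y (n + 1)) _ _) rfl
  rw [Subsingleton.elim (α := Ext W Z n) e' 0, Ext.zero_comp]

theorem IsSES.extZero_left_zero (h : IsSES f g) (h2 : ExtZero.{u} W Y 0) : ExtZero.{u} W X 0 := by
  rw [extZero_zero_iff] at h2 ⊢
  have := h.mono
  intro k
  rw [← cancel_mono f, h2 (k ≫ f), zero_comp]

theorem IsSES.exists_lift (h : IsSES f g) (h1 : ExtZero.{u} W X 1) (k : W ⟶ Z) :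
    ∃ l : W ⟶ Y, l ≫ g = k := by
  obtain ⟨w, hS⟩ := h
  obtain ⟨e, he⟩ := Ext.covariant_sequence_exact₃ W hS (Ext.mk₀ k) rfl
    (Subsingleton.elim (α := Ext W X 1) _ _)
  obtain ⟨l, rfl⟩ := (Ext.mk₀_bijective W Y).2 e
  rw [Ext.mk₀_comp_mk₀] at he
  exact ⟨l, (Ext.mk₀_bijective W Z).1 he⟩

/-- Every class in `Ext^1(W, X)` comes from some `k : W ⟶ Z` through the connecting map, which kills
the maps factoring through `g`. This is how approximation properties become Ext vanishing. -/
theorem IsSES.extZero_one_of_lift (h : IsSES f g) (h2 : ExtZero.{u} W Y 1)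
    (hl : ∀ k : W ⟶ Z, ∃ l : W ⟶ Y, l ≫ g = k) : ExtZero.{u} W X 1 := by
  obtain ⟨w, hS⟩ := h
  refine extZero_of_forall fun e => ?_
  obtain ⟨e', rfl⟩ := Ext.covariant_sequence_exact₁ W hS e
    (Subsingleton.elim (α := Ext W Y 1) _ _) rfl
  obtain ⟨k, rfl⟩ := (Ext.mk₀_bijective W Z).2 e'
  obtain ⟨l, rfl⟩ := hl k
  rw [← Ext.mk₀_comp_mk₀, Ext.comp_assoc_of_second_deg_zero, hS.comp_extClass, Ext.comp_zero]

end Covariant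

section Contravariant

variable (W : C)

theorem IsSES.zeroExt_mid (h : IsSES f g) {n : ℕ} (h1 : ExtZero.{u} X W n) (h3 : ExtZero.{u} Z W n) :
    ExtZero Y W n := by
  obtain ⟨w, hS⟩ := h
  refine extZero_of_forall fun e => ?_
  obtain ⟨e', rfl⟩ := Ext.contravariant_sequence_exact₂ hS W e
    (Subsingleton.elim (α := Ext X W n) _ _)
  rw [Subsingleton.elim (α := Ext Z W n) e' 0, Ext.comp_zero]

theorem IsSES.zeroExt_left (h : IsSES f g) {n : ℕ} (h2 : ExtZero.{u} Y W n)
    (h3 : ExtZero.{u} Z W (n + 1)) : ExtZero X W n := by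
  obtain ⟨w, hS⟩ := h
  refine extZero_of_forall fun e => ?_
  obtain ⟨e', rfl⟩ := Ext.contravariant_sequence_exact₁ hS W e (add_comm 1 n)
    (Subsingleton.elim (α := Ext Z W (n + 1)) _ _)
  rw [Subsingleton.elim (α := Ext Y W n) e' 0, Ext.comp_zero]

theorem IsSES.zeroExt_right (h : IsSES f g) {n : ℕ} (h1 : ExtZero.{u} X W n)
    (h2 : ExtZero.{u} Y W (n + 1)) : ExtZero Z W (n + 1) := by
  obtain ⟨w, hS⟩ := h
  refine extZero_of_forall fun e => ?_
  obtain ⟨e', rfl⟩ := Ext.contravariant_sequence_exact₃ hS W e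
    (Subsingleton.elim (α := Ext Y W (n + 1)) _ _) (add_comm 1 n)
  rw [Subsingleton.elim (α := Ext X W n) e' 0, Ext.comp_zero]

theorem IsSES.zeroExt_right_zero (h : IsSES f g) (h2 : ExtZero.{u} Y W 0) : ExtZero.{u} Z W 0 := by
  rw [extZero_zero_iff] at h2 ⊢
  have := h.epi
  intro k
  rw [← cancel_epi g, h2 (g ≫ k), comp_zero]

theorem IsSES.exists_desc (h : IsSES f g) (h3 : ExtZero.{u} Z W 1) (k : X ⟶ W) :
    ∃ l : Y ⟶ W, f ≫ l = k := by
  obtain ⟨w, hS⟩ := h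
  obtain ⟨e, he⟩ := Ext.contravariant_sequence_exact₁ hS W (Ext.mk₀ k) (n₁ := 1) rfl
    (Subsingleton.elim (α := Ext Z W 1) _ _)
  obtain ⟨l, rfl⟩ := (Ext.mk₀_bijective Y W).2 e
  rw [Ext.mk₀_comp_mk₀] at he
  exact ⟨l, (Ext.mk₀_bijective X W).1 he⟩

theorem IsSES.zeroExt_one_of_desc (h : IsSES f g) (h2 : ExtZero.{u} Y W 1)
    (hl : ∀ k : X ⟶ W, ∃ l : Y ⟶ W, f ≫ l = k) : ExtZero.{u} Z W 1 := by
  obtain ⟨w, hS⟩ := h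
  refine extZero_of_forall fun e => ?_
  obtain ⟨e', rfl⟩ := Ext.contravariant_sequence_exact₃ hS W e
    (Subsingleton.elim (α := Ext Y W 1) _ _) (n₀ := 0) rfl
  obtain ⟨k, rfl⟩ := (Ext.mk₀_bijective X W).2 e'
  obtain ⟨l, rfl⟩ := hl k
  rw [← Ext.mk₀_comp_mk₀, ← Ext.comp_assoc (h₁₂ := rfl) (h₂₃ := rfl), hS.extClass_comp, Ext.zero_comp]
  rfl

end Contravariant

end ExtVanishing

/-! ### Finitely generated modules and `add(T)` -/

section FiniteModules

variable {R : Type u} [Ring R]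

theorem finite_of_epi {M N : ModuleCat.{u} R} (f : M ⟶ N) [Epi f] (hM : Module.Finite R M) :
    Module.Finite R N :=
  Module.Finite.of_surjective f.hom ((ModuleCat.epi_iff_surjective f).1 inferInstance)

theorem finite_of_mono [IsNoetherianRing R] {M N : ModuleCat.{u} R} (f : M ⟶ N) [Mono f]
    (hN : Module.Finite R N) : Module.Finite R M :=
  Module.Finite.of_injective f.hom ((ModuleCat.mono_iff_injective f).1 inferInstance)

theorem finite_of_retract {M N : ModuleCat.{u} R} (r : Retract M N) (hN : Module.Finite R N) :
    Module.Finite R M :=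
  finite_of_epi r.r hN

theorem finite_of_iso {M N : ModuleCat.{u} R} (e : M ≅ N) (hM : Module.Finite R M) :
    Module.Finite R N :=
  finite_of_epi e.hom hM

variable {X Y Z : ModuleCat.{u} R} {f : X ⟶ Y} {g : Y ⟶ Z}

theorem IsSES.finite_right (h : IsSES f g) (hY : Module.Finite R Y) : Module.Finite R Z :=
  have := h.epi
  finite_of_epi g hY

theorem IsSES.finite_left [IsNoetherianRing R] (h : IsSES f g) (hY : Module.Finite R Y) :
    Module.Finite R X :=
  have := h.mono
  finite_of_mono f hY

/-- The direct sum `T ⊕ ⋯ ⊕ T` of `n` copies of `T`. -/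
abbrev power (T : ModuleCat.{u} R) (n : ℕ) : ModuleCat.{u} R := ModuleCat.of R (Fin n → T)

theorem finite_power {T : ModuleCat.{u} R} (hT : Module.Finite R T) (n : ℕ) :
    Module.Finite R (power T n) :=
  inferInstanceAs (Module.Finite R (Fin n → T))

/-- The projections of a finite power. -/
def power.π (T : ModuleCat.{u} R) (n : ℕ) (j : Fin n) : power T n ⟶ T :=
  ModuleCat.ofHom (LinearMap.proj j)

/-- The inclusions into a finite power. -/
def power.ι (T : ModuleCat.{u} R) (n : ℕ) (j : Fin n) : T ⟶ power T n :=
  ModuleCat.ofHom (LinearMap.single R (fun _ : Fin n => T) j)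

/-- The map to a finite power with given components. -/
def power.lift {X T : ModuleCat.{u} R} {n : ℕ} (s : Fin n → (X ⟶ T)) : X ⟶ power T n :=
  ModuleCat.ofHom (LinearMap.pi fun j => (s j).hom)

/-- The map from a finite power with given components. -/
def power.desc {X T : ModuleCat.{u} R} {n : ℕ} (s : Fin n → (T ⟶ X)) : power T n ⟶ X :=
  ∑ j, power.π T n j ≫ s j

@[simp]
theorem power.lift_π {X T : ModuleCat.{u} R} {n : ℕ} (s : Fin n → (X ⟶ T)) (j : Fin n) :
    power.lift s ≫ power.π T n j = s j := rfl

theorem power.lift_π_assoc {X T Y : ModuleCat.{u} R} {n : ℕ} (s : Fin n → (X ⟶ T)) (j : Fin n)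
    (h : T ⟶ Y) : power.lift s ≫ power.π T n j ≫ h = s j ≫ h := rfl

@[simp]
theorem power.ι_π_self (T : ModuleCat.{u} R) (n : ℕ) (j : Fin n) :
    power.ι T n j ≫ power.π T n j = 𝟙 T := by
  ext x
  simp [power.ι, power.π]

theorem power.ι_π_ne (T : ModuleCat.{u} R) (n : ℕ) {j k : Fin n} (h : j ≠ k) :
    power.ι T n j ≫ power.π T n k = 0 := by
  ext x
  simp [power.ι, power.π, h]

@[simp]
theorem power.ι_desc {X T : ModuleCat.{u} R} {n : ℕ} (s : Fin n → (T ⟶ X)) (j : Fin n) :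
    power.ι T n j ≫ power.desc s = s j := by
  rw [power.desc, Preadditive.comp_sum, Finset.sum_eq_single j]
  · rw [← Category.assoc, power.ι_π_self, Category.id_comp]
  · intro k _ hk
    rw [← Category.assoc, power.ι_π_ne T n hk.symm, zero_comp]
  · simp

theorem power.ι_desc_assoc {X T Y : ModuleCat.{u} R} {n : ℕ} (s : Fin n → (T ⟶ X)) (j : Fin n)
    (h : X ⟶ Y) : power.ι T n j ≫ power.desc s ≫ h = s j ≫ h := by
  rw [← Category.assoc, power.ι_desc]

theorem power.total (T : ModuleCat.{u} R) (n : ℕ) :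
    ∑ j, power.π T n j ≫ power.ι T n j = 𝟙 (power T n) := by
  apply ModuleCat.hom_ext
  apply LinearMap.ext
  intro x
  rw [ModuleCat.hom_sum, LinearMap.sum_apply]
  exact Finset.univ_sum_single (f := x)

theorem addClosure_power (T : ModuleCat.{u} R) (n : ℕ) : addClosure T (power T n) :=
  ⟨n, ⟨Retract.refl _⟩⟩

theorem addClosure_self (T : ModuleCat.{u} R) : addClosure T T :=
  ⟨1, ⟨⟨power.ι T 1 0, power.π T 1 0, power.ι_π_self T 1 0⟩⟩⟩

/-- The working form of membership in `add(T)`: any additive vanishing property of `T` passes to `M`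
by inserting this decomposition of the identity. -/
theorem addClosure.exists_sum_eq_id {T M : ModuleCat.{u} R} (h : addClosure T M) :
    ∃ (n : ℕ) (a : Fin n → (M ⟶ T)) (b : Fin n → (T ⟶ M)), ∑ j, a j ≫ b j = 𝟙 M := by
  obtain ⟨n, ⟨r⟩⟩ := h
  refine ⟨n, fun j => r.i ≫ power.π T n j, fun j => power.ι T n j ≫ r.r, ?_⟩
  have h : ∀ j, (r.i ≫ power.π T n j) ≫ power.ι T n j ≫ r.r =
    r.i ≫ (power.π T n j ≫ power.ι T n j) ≫ r.r := by simp
  simp only [h]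
  rw [← Preadditive.comp_sum, ← Preadditive.sum_comp, power.total, Category.id_comp, r.retract]

theorem addClosure.finite {T M : ModuleCat.{u} R} (h : addClosure T M) (hT : Module.Finite R T) :
    Module.Finite R M := by
  obtain ⟨n, ⟨r⟩⟩ := h
  exact finite_of_retract r (finite_power hT n)

theorem mk₀_sum {C : Type*} [Category C] [Abelian C] [HasExt.{u} C] {X Y : C} {n : ℕ}
    (s : Fin n → (X ⟶ Y)) : Ext.mk₀ (∑ j, s j) = ∑ j, Ext.mk₀ (s j) :=
  map_sum Ext.addEquiv₀.symm s Finset.univ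

theorem addClosure.extZero_left {T M Y : ModuleCat.{u} R} (h : addClosure T M) {k : ℕ}
    (hT : ExtZero.{u} T Y k) : ExtZero M Y k := by
  obtain ⟨n, a, b, hab⟩ := h.exists_sum_eq_id
  refine extZero_of_forall fun e => ?_
  rw [← Ext.mk₀_id_comp e, ← hab, mk₀_sum, Ext.sum_comp]
  refine Finset.sum_eq_zero fun j _ => ?_
  rw [← Ext.mk₀_comp_mk₀_assoc, Subsingleton.elim ((Ext.mk₀ (b j)).comp e (zero_add k)) 0,
    Ext.comp_zero]

theorem addClosure.extZero_right {T M Y : ModuleCat.{u} R} (h : addClosure T M) {k : ℕ}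
    (hT : ExtZero.{u} Y T k) : ExtZero Y M k := by
  obtain ⟨n, a, b, hab⟩ := h.exists_sum_eq_id
  refine extZero_of_forall fun e => ?_
  rw [← Ext.comp_mk₀_id e, ← hab, mk₀_sum, Ext.comp_sum]
  refine Finset.sum_eq_zero fun j _ => ?_
  rw [← Ext.mk₀_comp_mk₀, ← Ext.comp_assoc_of_third_deg_zero,
    Subsingleton.elim (e.comp (Ext.mk₀ (a j)) (add_zero k)) 0, Ext.zero_comp]

theorem leftPerp_addClosure_iff {T X : ModuleCat.{u} R} :
    leftPerp (addClosure T) X ↔ Module.Finite R X ∧ ∀ n, ExtZero.{u} X T (n + 1) :=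
  ⟨fun h => ⟨h.1, fun n => h.2 T (addClosure_self T) (n + 1) (by omega)⟩,
    fun h => ⟨h.1, fun Y hY n hn => by
      obtain ⟨m, rfl⟩ := Nat.exists_eq_add_of_le' hn
      exact hY.extZero_right (h.2 m)⟩⟩

theorem rightPerp_addClosure_iff {T Y : ModuleCat.{u} R} :
    rightPerp (addClosure T) Y ↔ Module.Finite R Y ∧ ∀ n, ExtZero.{u} T Y (n + 1) :=
  ⟨fun h => ⟨h.1, fun n => h.2 T (addClosure_self T) (n + 1) (by omega)⟩,
    fun h => ⟨h.1, fun X hX n hn => by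
      obtain ⟨m, rfl⟩ := Nat.exists_eq_add_of_le' hn
      exact hX.extZero_left (h.2 m)⟩⟩

/-- The free module of rank `n`, as an object of the module category. -/
abbrev regular (R : Type u) [Ring R] : ModuleCat.{u} R := ModuleCat.of R R

theorem finite_regular : Module.Finite R (regular R) := inferInstanceAs (Module.Finite R R)

theorem exists_epi_power_regular (M : ModuleCat.{u} R) (hM : Module.Finite R M) :
    ∃ (n : ℕ) (f : power (regular R) n ⟶ M), Epi f := by
  obtain ⟨n, f, hf⟩ := Module.Finite.exists_fin' R M
  exact ⟨n, ModuleCat.ofHom f, (ModuleCat.epi_iff_surjective _).2 hf⟩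

instance projective_regular : Projective (regular R) :=
  (IsProjective.iff_projective R).1 (inferInstanceAs (Module.Projective R R))

instance projective_power_regular (n : ℕ) : Projective (power (regular R) n) :=
  (IsProjective.iff_projective (Fin n → R)).1 inferInstance

theorem addClosure_regular_iff {P : ModuleCat.{u} R} :
    addClosure (regular R) P ↔ Projective P ∧ Module.Finite R P := by
  refine ⟨fun h => ⟨?_, h.finite finite_regular⟩, fun ⟨hP, hfin⟩ => ?_⟩
  · obtain ⟨n, ⟨r⟩⟩ := h
    exact r.projective
  · obtain ⟨n, f, hf⟩ := exists_epi_power_regular P hfin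
    exact ⟨n, ⟨⟨Projective.factorThru (𝟙 P) f, f, Projective.factorThru_comp _ _⟩⟩⟩

theorem exists_ses_projective [IsNoetherianRing R] (M : ModuleCat.{u} R) (hM : Module.Finite R M) :
    ∃ (N P : ModuleCat.{u} R) (f : N ⟶ P) (g : P ⟶ M), IsSES f g ∧ Module.Finite R N ∧
      Projective P ∧ Module.Finite R P := by
  obtain ⟨n, g, hg⟩ := exists_epi_power_regular M hM
  have h := IsSES.of_epi g
  exact ⟨_, _, _, _, h, h.finite_left (finite_power finite_regular n), inferInstance,
    finite_power finite_regular n⟩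

end FiniteModules

/-! ### Approximations by powers of a module -/

section Approximation

variable {R : Type u} [Ring R]

open scoped ModuleCat

theorem finite_hom (K : Type u) [Field K] [Algebra K R] [Module.Finite K R]
    (X T : ModuleCat.{u} R) (hX : Module.Finite R X) (hT : Module.Finite R T) :
    Module.Finite K (X ⟶ T) := by
  have : Module.Finite K X := Module.Finite.trans R X
  have : Module.Finite K T := Module.Finite.trans R T
  let φ : (X ⟶ T) →ₗ[K] (X →ₗ[K] T) :=
    { toFun := fun f => f.hom.restrictScalars K
      map_add' := fun _ _ => rfl
      map_smul' := fun _ _ => rfl }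
  refine Module.Finite.of_injective φ fun f g hfg => ?_
  ext x
  exact LinearMap.congr_fun hfg x

/-- A left approximation of `X` by a power of `T`. -/
theorem exists_left_approximation (K : Type u) [Field K] [Algebra K R] [Module.Finite K R]
    (X T : ModuleCat.{u} R) (hX : Module.Finite R X)
    (hT : Module.Finite R T) :
    ∃ (n : ℕ) (f : X ⟶ power T n), ∀ k : X ⟶ T, ∃ l : power T n ⟶ T, f ≫ l = k := by
  have := finite_hom K X T hX hT
  obtain ⟨n, s, hs⟩ := Module.Finite.exists_fin (R := K) (M := X ⟶ T)
  refine ⟨n, power.lift s, fun k => ?_⟩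
  have hk : k ∈ Submodule.span K (Set.range s) := hs ▸ Submodule.mem_top
  obtain ⟨c, rfl⟩ := (Submodule.mem_span_range_iff_exists_fun K).1 hk
  exact ⟨∑ j, c j • power.π T n j, by simp [Preadditive.comp_sum]⟩

/-- A right approximation of `Y` by a power of `T`. -/
theorem exists_right_approximation (K : Type u) [Field K] [Algebra K R] [Module.Finite K R]
    (Y T : ModuleCat.{u} R) (hY : Module.Finite R Y)
    (hT : Module.Finite R T) :
    ∃ (n : ℕ) (f : power T n ⟶ Y), ∀ k : T ⟶ Y, ∃ l : T ⟶ power T n, l ≫ f = k := by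
  have := finite_hom K T Y hT hY
  obtain ⟨n, s, hs⟩ := Module.Finite.exists_fin (R := K) (M := T ⟶ Y)
  refine ⟨n, power.desc s, fun k => ?_⟩
  have hk : k ∈ Submodule.span K (Set.range s) := hs ▸ Submodule.mem_top
  obtain ⟨c, rfl⟩ := (Submodule.mem_span_range_iff_exists_fun K).1 hk
  exact ⟨∑ j, c j • power.ι T n j, by simp [Preadditive.sum_comp]⟩

end Approximation

/-! ### Ext orthogonality along finite (co)resolutions -/

section Orthogonality

variable {R : Type u} [Ring R]

theorem HasResolution.extZero_right {U X : ModuleCat.{u} R} (hX : ∀ n, ExtZero.{u} X U (n + 1)) :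
    ∀ {m : ℕ} {N : ModuleCat.{u} R}, HasResolution (addClosure U) m N → ∀ n, ExtZero.{u} X N (n + 1)
  | 0, _, ⟨_, hC, ⟨e⟩⟩, n => (hC.extZero_right (hX n)).retract_right (.ofIso e.symm)
  | _ + 1, _, ⟨_, _, _, _, w, hS, hC, hN⟩, n =>
    IsSES.extZero_right X ⟨w, hS⟩ (hC.extZero_right (hX n)) (hN.extZero_right hX (n + 1))

theorem HasCoresolution.extZero_left {U Y : ModuleCat.{u} R} (hY : ∀ n, ExtZero.{u} U Y (n + 1)) :
    ∀ {m : ℕ} {M : ModuleCat.{u} R}, HasCoresolution (addClosure U) m M →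
      ∀ n, ExtZero.{u} M Y (n + 1)
  | 0, _, ⟨_, hC, ⟨e⟩⟩, n => (hC.extZero_left (hY n)).retract_left (.ofIso e)
  | _ + 1, _, ⟨_, _, _, _, w, hS, hC, hN⟩, n =>
    IsSES.zeroExt_left Y ⟨w, hS⟩ (hC.extZero_left (hY n)) (hN.extZero_left hY (n + 1))

/-- `J` cogenerates the finitely generated modules. -/
def IsCogenerator (J : ModuleCat.{u} R) : Prop :=
  ∀ X : ModuleCat.{u} R, Module.Finite R X → ∀ x : X, (∀ φ : X ⟶ J, φ.hom x = 0) → x = 0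

/-- The kernel of the last map of the resolution has a finite `add(U)`-resolution itself, so
`Ext^1(X, -)` vanishes on it for `X` in `⊥U`, and maps from `X` lift. -/
theorem HasResolution.exists_epi {U J : ModuleCat.{u} R} {m : ℕ}
    (h : HasResolution (addClosure U) m J) :
    ∃ (U₀ : ModuleCat.{u} R) (p : U₀ ⟶ J), addClosure U U₀ ∧
      ∀ X : ModuleCat.{u} R, (∀ n, ExtZero.{u} X U (n + 1)) → ∀ k : X ⟶ J, ∃ l, l ≫ p = k := by
  cases m with
  | zero =>
    obtain ⟨U₀, hU, ⟨e⟩⟩ := h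
    exact ⟨U₀, e.hom, hU, fun X _ k => ⟨k ≫ e.inv, by simp⟩⟩
  | succ m =>
    obtain ⟨N, U₀, f, g, w, hS, hU, hN⟩ := h
    exact ⟨U₀, g, hU, fun X hX k =>
      IsSES.exists_lift X ⟨w, hS⟩ (hN.extZero_right hX 0) k⟩

theorem HasCoresolution.exists_mono {U J : ModuleCat.{u} R} {m : ℕ}
    (h : HasCoresolution (addClosure U) m J) :
    ∃ (U₀ : ModuleCat.{u} R) (p : J ⟶ U₀), addClosure U U₀ ∧
      ∀ Y : ModuleCat.{u} R, (∀ n, ExtZero.{u} U Y (n + 1)) → ∀ k : J ⟶ Y, ∃ l, p ≫ l = k := by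
  cases m with
  | zero =>
    obtain ⟨U₀, hU, ⟨e⟩⟩ := h
    exact ⟨U₀, e.hom, hU, fun X _ k => ⟨e.inv ≫ k, by simp⟩⟩
  | succ m =>
    obtain ⟨U₀, N, f, g, w, hS, hU, hN⟩ := h
    exact ⟨U₀, f, hU, fun Y hY k =>
      IsSES.exists_desc Y ⟨w, hS⟩ (hN.extZero_left hY 0) k⟩

theorem addClosure.eq_zero_of_forall {U U₀ : ModuleCat.{u} R} (h : addClosure U U₀)
    {X : ModuleCat.{u} R} {x : X} (hx : ∀ φ : X ⟶ U, φ.hom x = 0) (φ : X ⟶ U₀) : φ.hom x = 0 := by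
  obtain ⟨n, a, b, hab⟩ := h.exists_sum_eq_id
  have hφ : φ = ∑ j, (φ ≫ a j) ≫ b j := by
    simp only [Category.assoc]
    rw [← Preadditive.comp_sum, hab, Category.comp_id]
  rw [hφ, ModuleCat.hom_sum, LinearMap.sum_apply]
  refine Finset.sum_eq_zero fun j _ => ?_
  rw [ModuleCat.hom_comp, LinearMap.comp_apply, hx, map_zero]

theorem addClosure.mem_of_forall {U U₀ : ModuleCat.{u} R} (h : addClosure U U₀)
    {Y : ModuleCat.{u} R} {N : Submodule R Y} (hN : ∀ (φ : U ⟶ Y) x, φ.hom x ∈ N) (φ : U₀ ⟶ Y)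
    (x : U₀) : φ.hom x ∈ N := by
  obtain ⟨n, a, b, hab⟩ := h.exists_sum_eq_id
  have hφ : φ = ∑ j, a j ≫ (b j ≫ φ) := by
    simp only [← Category.assoc]
    rw [← Preadditive.sum_comp, hab, Category.id_comp]
  rw [hφ, ModuleCat.hom_sum, LinearMap.sum_apply]
  refine Submodule.sum_mem _ fun j _ => ?_
  rw [ModuleCat.hom_comp, LinearMap.comp_apply]
  exact hN _ _

/-- If `X` is embedded in a power of `U` by a left approximation, the cokernel is again in `⊥U`. -/
theorem exists_ses_power_of_separating (K : Type u) [Field K] [Algebra K R] [Module.Finite K R]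
    {U X : ModuleCat.{u} R} (hU : Module.Finite R U)
    (hUU : ∀ n, ExtZero.{u} U U (n + 1)) (hX : Module.Finite R X)
    (hXU : ∀ n, ExtZero.{u} X U (n + 1))
    (hsep : ∀ x : X, (∀ φ : X ⟶ U, φ.hom x = 0) → x = 0) :
    ∃ (n : ℕ) (X' : ModuleCat.{u} R) (f : X ⟶ power U n) (g : power U n ⟶ X'), IsSES f g ∧
      Module.Finite R X' ∧ (∀ n, ExtZero.{u} X' U (n + 1)) ∧
      ∀ k : X ⟶ U, ∃ l : power U n ⟶ U, f ≫ l = k := by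
  obtain ⟨n, f, hf⟩ := exists_left_approximation K X U hX hU
  have : Mono f := by
    rw [ModuleCat.mono_iff_injective, injective_iff_map_eq_zero]
    refine fun x hx => hsep x fun φ => ?_
    obtain ⟨l, rfl⟩ := hf φ
    rw [ModuleCat.hom_comp, LinearMap.comp_apply]
    exact (congrArg l.hom hx).trans (map_zero _)
  have h := IsSES.of_mono f
  refine ⟨n, _, f, _, h, h.finite_right (finite_power hU n), fun m => ?_, hf⟩
  have hP := fun m => (addClosure_power U n).extZero_left (hUU m)
  cases m with
  | zero => exact h.zeroExt_one_of_desc U (hP 0) hf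
  | succ m => exact h.zeroExt_right U (hXU m) (hP (m + 1))

/-- A right approximation by `U` is onto because `U` generates `Y`. Surjectivity of `Hom(U, U^n) →
Hom(U, Y)` kills `Ext^1(U, Y')`, and the higher degrees shift. -/
theorem exists_ses_power_of_generating (K : Type u) [Field K] [Algebra K R] [Module.Finite K R]
    {U Y : ModuleCat.{u} R} [IsNoetherianRing R]
    (hU : Module.Finite R U)
    (hUU : ∀ n, ExtZero.{u} U U (n + 1)) (hY : Module.Finite R Y)
    (hYU : ∀ n, ExtZero.{u} U Y (n + 1))
    (hgen : ∀ N : Submodule R Y, (∀ (φ : U ⟶ Y) x, φ.hom x ∈ N) → N = ⊤) :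
    ∃ (n : ℕ) (Y' : ModuleCat.{u} R) (f : Y' ⟶ power U n) (g : power U n ⟶ Y), IsSES f g ∧
      Module.Finite R Y' ∧ (∀ n, ExtZero.{u} U Y' (n + 1)) ∧
      ∀ k : U ⟶ Y, ∃ l : U ⟶ power U n, l ≫ g = k := by
  obtain ⟨n, g, hg⟩ := exists_right_approximation K Y U hY hU
  have : Epi g := by
    rw [ModuleCat.epi_iff_range_eq_top]
    refine hgen _ fun φ x => ?_
    obtain ⟨l, rfl⟩ := hg φ
    exact ⟨l.hom x, rfl⟩
  have h := IsSES.of_epi g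
  refine ⟨n, _, _, g, h, h.finite_left (finite_power hU n), fun m => ?_, hg⟩
  have hP := fun m => (addClosure_power U n).extZero_right (hUU m)
  cases m with
  | zero => exact h.extZero_one_of_lift U (hP 0) hg
  | succ m => exact h.extZero_left U (hYU m) (hP (m + 1))

/-- Maps from `X` to the cogenerator factor through a module in `add(U)`, so maps to `U` already
separate the points of `X`. -/
theorem separating_of_hasResolution {U J X : ModuleCat.{u} R} (hJ : IsCogenerator J) {m : ℕ}
    (hres : HasResolution (addClosure U) m J) (hX : Module.Finite R X)
    (hXU : ∀ n, ExtZero.{u} X U (n + 1)) (x : X) (hx : ∀ φ : X ⟶ U, φ.hom x = 0) : x = 0 := by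
  obtain ⟨U₀, p, hU₀, hp⟩ := hres.exists_epi
  refine hJ X hX x fun φ => ?_
  obtain ⟨l, rfl⟩ := hp X hXU φ
  rw [ModuleCat.hom_comp, LinearMap.comp_apply, hU₀.eq_zero_of_forall hx, map_zero]

/-- An element of `Y` is a map from the regular module, and this extends to the first term of the
coresolution, which lies in `add(U)`. -/
theorem generating_of_hasCoresolution {U Y : ModuleCat.{u} R} {m : ℕ}
    (hres : HasCoresolution (addClosure U) m (regular R))
    (hYU : ∀ n, ExtZero.{u} U Y (n + 1)) (N : Submodule R Y)
    (hN : ∀ (φ : U ⟶ Y) x, φ.hom x ∈ N) : N = ⊤ := by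
  obtain ⟨U₀, p, hU₀, hp⟩ := hres.exists_mono
  refine eq_top_iff.2 fun y _ => ?_
  obtain ⟨l, hl⟩ := hp Y hYU (ModuleCat.ofHom (LinearMap.toSpanSingleton R Y y))
  have h1 : (p ≫ l).hom (1 : R) = y := by
    rw [hl]
    exact LinearMap.toSpanSingleton_apply_one R Y y
  rw [← h1]
  exact hU₀.mem_of_forall hN l _

end Orthogonality

/-! ### Homological dimensions tested on finitely generated modules -/

section Dimension

variable {R : Type u} [Ring R]

theorem projectiveDimension_le_iff_extZero {M : ModuleCat.{u} R} {i : ℕ} :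
    projectiveDimension M ≤ (i : WithBot ℕ∞) ↔
      ∀ (Y : ModuleCat.{u} R) n, ExtZero.{u} M Y (i + 1 + n) := by
  rw [projectiveDimension_le_iff]
  refine ⟨fun h Y n => HasProjectiveDimensionLT.subsingleton M (i + 1) _ (by omega) Y,
    fun h => HasProjectiveDimensionLT.mk fun k hk Y e => ?_⟩
  obtain ⟨m, rfl⟩ := Nat.exists_eq_add_of_le hk
  have := h Y m
  exact Subsingleton.elim _ _

theorem injectiveDimension_le_iff_extZero {M : ModuleCat.{u} R} {i : ℕ} :
    injectiveDimension M ≤ (i : WithBot ℕ∞) ↔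
      ∀ (Y : ModuleCat.{u} R) n, ExtZero.{u} Y M (i + 1 + n) := by
  rw [injectiveDimension_le_iff]
  refine ⟨fun h Y n => HasInjectiveDimensionLT.subsingleton M (i + 1) _ (by omega) Y,
    fun h => HasInjectiveDimensionLT.mk fun k hk Y e => ?_⟩
  obtain ⟨m, rfl⟩ := Nat.exists_eq_add_of_le hk
  have := h Y m
  exact Subsingleton.elim _ _

/-- Every finitely generated module embeds into a finitely generated injective module. -/
def EnoughFiniteInjectives (R : Type u) [Ring R] : Prop :=
  ∀ M : ModuleCat.{u} R, Module.Finite R M →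
    ∃ (J : ModuleCat.{u} R) (f : M ⟶ J), Mono f ∧ Injective J ∧ Module.Finite R J

theorem EnoughFiniteInjectives.exists_ses (h : EnoughFiniteInjectives R) (M : ModuleCat.{u} R)
    (hM : Module.Finite R M) :
    ∃ (J N : ModuleCat.{u} R) (f : M ⟶ J) (g : J ⟶ N), IsSES f g ∧ Injective J ∧
      Module.Finite R J ∧ Module.Finite R N := by
  obtain ⟨J, f, hf, hJ, hJfin⟩ := h M hM
  have hs := IsSES.of_mono f
  exact ⟨J, _, f, _, hs, hJ, hJfin, hs.finite_right hJfin⟩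

/-- The perpendicular classes see only finitely generated modules, whereas the projective dimension
is taken among all modules. The gap closes because a vanishing Ext into the finitely generated
syzygy already splits the projective cover map of the last step. -/
theorem projectiveDimension_le_of_finite [IsNoetherianRing R] {i : ℕ} {M : ModuleCat.{u} R}
    (hM : Module.Finite R M)
    (h : ∀ Y : ModuleCat.{u} R, Module.Finite R Y → ExtZero.{u} M Y (i + 1)) :
    projectiveDimension M ≤ (i : WithBot ℕ∞) := by
  rw [projectiveDimension_le_iff]
  induction i generalizing M with
  | zero =>
    obtain ⟨N, P, f, g, hs, hN, hP, hPfin⟩ := exists_ses_projective M hM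
    obtain ⟨l, hl⟩ := hs.exists_lift M (h N hN) (𝟙 M)
    have : Projective M := (Retract.mk l g hl).projective
    exact (projective_iff_hasProjectiveDimensionLE_zero M).1 this
  | succ i ih =>
    obtain ⟨N, P, f, g, hs, hN, hP, hPfin⟩ := exists_ses_projective M hM
    have := ih hN fun Y hY => hs.zeroExt_left Y (.of_projective P Y i) (h Y hY)
    obtain ⟨w, hS⟩ := hs
    exact (hS.hasProjectiveDimensionLT_X₃_iff i hP).2 this

theorem injectiveDimension_le_of_finite (hR : EnoughFiniteInjectives R) {i : ℕ}
    {M : ModuleCat.{u} R} (hM : Module.Finite R M)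
    (h : ∀ Y : ModuleCat.{u} R, Module.Finite R Y → ExtZero.{u} Y M (i + 1)) :
    injectiveDimension M ≤ (i : WithBot ℕ∞) := by
  rw [injectiveDimension_le_iff]
  induction i generalizing M with
  | zero =>
    obtain ⟨J, N, f, g, hs, hJ, hJfin, hN⟩ := hR.exists_ses M hM
    obtain ⟨l, hl⟩ := hs.exists_desc M (h N hN) (𝟙 M)
    have : Injective M := (Retract.mk f l hl).injective
    exact injective_iff_hasInjectiveDimensionLT_one.1 this
  | succ i ih =>
    obtain ⟨J, N, f, g, hs, hJ, hJfin, hN⟩ := hR.exists_ses M hM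
    have := ih hN fun Y hY => hs.extZero_right Y (.of_injective Y J i) (h Y hY)
    obtain ⟨w, hS⟩ := hs
    exact (hS.hasInjectiveDimensionLT_X₃_iff i hJ).1 this

end Dimension

/-! ### Perpendicular classes -/

section Perp

variable {R : Type u} [Ring R]

theorem rightPerp_of_injective {J : ModuleCat.{u} R} (hJ : Injective J) (hfin : Module.Finite R J)
    (D : ObjectProperty (ModuleCat.{u} R)) : rightPerp D J :=
  ⟨hfin, fun X _ n hn => by
    obtain ⟨m, rfl⟩ := Nat.exists_eq_add_of_le' hn
    exact ExtZero.of_injective X J m⟩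

theorem leftPerp_of_projective {P : ModuleCat.{u} R} (hP : Projective P)
    (hfin : Module.Finite R P) (D : ObjectProperty (ModuleCat.{u} R)) : leftPerp D P :=
  ⟨hfin, fun X _ n hn => by
    obtain ⟨m, rfl⟩ := Nat.exists_eq_add_of_le' hn
    exact ExtZero.of_projective P X m⟩

theorem leftPerp.extZero {D : ObjectProperty (ModuleCat.{u} R)} {X Y : ModuleCat.{u} R}
    (hX : leftPerp D X) (hY : D Y) (n : ℕ) : ExtZero.{u} X Y (n + 1) :=
  hX.2 Y hY (n + 1) (by omega)

theorem rightPerp.extZero {D : ObjectProperty (ModuleCat.{u} R)} {X Y : ModuleCat.{u} R}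
    (hY : rightPerp D Y) (hX : D X) (n : ℕ) : ExtZero.{u} X Y (n + 1) :=
  hY.2 X hX (n + 1) (by omega)

theorem leftPerp_of_extZero {D : ObjectProperty (ModuleCat.{u} R)} {X : ModuleCat.{u} R}
    (hX : Module.Finite R X) (h : ∀ Y, D Y → ∀ n, ExtZero.{u} X Y (n + 1)) : leftPerp D X :=
  ⟨hX, fun Y hY n hn => by
    obtain ⟨m, rfl⟩ := Nat.exists_eq_add_of_le' hn
    exact h Y hY m⟩

theorem rightPerp_of_extZero {D : ObjectProperty (ModuleCat.{u} R)} {Y : ModuleCat.{u} R}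
    (hY : Module.Finite R Y) (h : ∀ X, D X → ∀ n, ExtZero.{u} X Y (n + 1)) : rightPerp D Y :=
  ⟨hY, fun X hX n hn => by
    obtain ⟨m, rfl⟩ := Nat.exists_eq_add_of_le' hn
    exact h X hX m⟩

variable {T : ModuleCat.{u} R}

theorem IsTilting.extZero_self (hT : IsTilting T) (n : ℕ) : ExtZero.{u} T T (n + 1) :=
  hT.ext_self (n + 1) (by omega)

theorem IsTilting.rightPerp_self (hT : IsTilting T) : rightPerp (addClosure T) T :=
  rightPerp_addClosure_iff.2 ⟨hT.finite, hT.extZero_self⟩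

/-- A cotilting module, relative to a chosen injective cogenerator `J`. -/
structure IsCotiltingFor (J T : ModuleCat.{u} R) : Prop where
  finite : Module.Finite R T
  extZero_self : ∀ n : ℕ, ExtZero.{u} T T (n + 1)
  cogenerator : IsCogenerator J
  resolution : ∃ n, HasResolution (addClosure T) n J

theorem IsCotiltingFor.leftPerp_self {J : ModuleCat.{u} R} (hT : IsCotiltingFor J T) : leftPerp (addClosure T) T :=
  leftPerp_addClosure_iff.2 ⟨hT.finite, hT.extZero_self⟩

end Perp

/-! ### Tilting modules: `⊥(T⊥)` and finite `add(T)`-coresolutions -/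

section Tilting

variable {R : Type u} [Ring R]
  {T : ModuleCat.{u} R}

theorem IsTilting.exists_ses_of_rightPerp (K : Type u) [Field K] [Algebra K R] [Module.Finite K R]
    [IsNoetherianRing R] (hT : IsTilting T) {Y : ModuleCat.{u} R}
    (hY : rightPerp (addClosure T) Y) :
    ∃ (n : ℕ) (Y' : ModuleCat.{u} R) (f : Y' ⟶ power T n) (g : power T n ⟶ Y), IsSES f g ∧
      rightPerp (addClosure T) Y' := by
  obtain ⟨hfin, hY⟩ := rightPerp_addClosure_iff.1 hY
  obtain ⟨m, hm⟩ := hT.coresolution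
  obtain ⟨n, Y', f, g, hs, hfin', hY', -⟩ := exists_ses_power_of_generating K hT.finite
    hT.extZero_self hfin hY (generating_of_hasCoresolution hm hY)
  exact ⟨n, Y', f, g, hs, rightPerp_addClosure_iff.2 ⟨hfin', hY'⟩⟩

/-- Embed `M` in an injective, which lies in `T⊥` and hence is a quotient of some `T^m` with kernel
in `T⊥`. The embedding lifts to `T^m`, so `T` cogenerates `M` and a left approximation is mono. -/
theorem IsTilting.exists_ses_of_leftPerp (K : Type u) [Field K] [Algebra K R] [Module.Finite K R]
    [IsNoetherianRing R] (hT : IsTilting T) (hR : EnoughFiniteInjectives R)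
    {M : ModuleCat.{u} R} (hM : leftPerp (rightPerp (addClosure T)) M) :
    ∃ (n : ℕ) (N : ModuleCat.{u} R) (f : M ⟶ power T n) (g : power T n ⟶ N), IsSES f g ∧
      leftPerp (rightPerp (addClosure T)) N := by
  have hMT := hM.extZero hT.rightPerp_self
  obtain ⟨n, N, f, g, hs, hN, -, hf⟩ := exists_ses_power_of_separating K hT.finite
    hT.extZero_self hM.1 hMT fun x hx => by
      obtain ⟨J, e, he, hJ, hJfin⟩ := hR M hM.1
      obtain ⟨m, Y', a, b, hab, hY'⟩ :=
        hT.exists_ses_of_rightPerp K (rightPerp_of_injective hJ hJfin _)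
      obtain ⟨l, hl⟩ := hab.exists_lift M (hM.extZero hY' 0) e
      have h1 : e.hom x = 0 := by
        rw [← hl, ModuleCat.hom_comp, LinearMap.comp_apply,
          (addClosure_power T m).eq_zero_of_forall hx l, map_zero]
      exact (injective_iff_map_eq_zero _).1 ((ModuleCat.mono_iff_injective e).1 he) x h1
  refine ⟨n, N, f, g, hs, leftPerp_of_extZero hN fun Y hY k => ?_⟩
  have hP := fun k => (addClosure_power T n).extZero_left (hY.extZero (addClosure_self T) k)
  cases k with
  | succ k => exact hs.zeroExt_right Y (hM.extZero hY k) (hP (k + 1))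
  | zero =>
    refine hs.zeroExt_one_of_desc Y (hP 0) fun k => ?_
    -- To extend a map `M ⟶ Y` along `f`, lift it to a power of `T` covering `Y`; each component
    -- then extends because `f` is a left `T`-approximation.
    obtain ⟨m, Y', a, b, hab, hY'⟩ := hT.exists_ses_of_rightPerp K hY
    obtain ⟨l, rfl⟩ := hab.exists_lift M (hM.extZero hY' 0) k
    choose t ht using fun j => hf (l ≫ power.π T m j)
    refine ⟨power.lift t ≫ b, ?_⟩
    rw [← Category.assoc]
    congr 1
    rw [← Category.comp_id l, ← power.total T m, Preadditive.comp_sum]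
    rw [← Category.comp_id (f ≫ power.lift t), ← power.total T m, Preadditive.comp_sum]
    refine Finset.sum_congr rfl fun j _ => ?_
    rw [Category.assoc, power.lift_π_assoc, ← Category.assoc, ht, Category.assoc]

/-- The epimorphism from a power of `T` onto `M` has kernel in `T⊥`, so it splits. -/
theorem IsTilting.addClosure_of_perp (K : Type u) [Field K] [Algebra K R] [Module.Finite K R]
    [IsNoetherianRing R] (hT : IsTilting T) {M : ModuleCat.{u} R}
    (hM : leftPerp (rightPerp (addClosure T)) M) (hM' : rightPerp (addClosure T) M) :
    addClosure T M := by
  obtain ⟨n, Y', f, g, hs, hY'⟩ := hT.exists_ses_of_rightPerp K hM'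
  obtain ⟨l, hl⟩ := hs.exists_lift M (hM.extZero hY' 0) (𝟙 M)
  exact ⟨n, ⟨⟨l, g, hl⟩⟩⟩

/-- Each cosyzygy stays in `⊥(T⊥)` and lowers by one the degree above which `Ext(T, -)` vanishes;
after `i` steps it is also in `T⊥`, hence in `add(T)`. -/
theorem IsTilting.hasCoresolution (K : Type u) [Field K] [Algebra K R] [Module.Finite K R]
    [IsNoetherianRing R] (hT : IsTilting T) (hR : EnoughFiniteInjectives R) {i : ℕ}
    {M : ModuleCat.{u} R} (hM : leftPerp (rightPerp (addClosure T)) M)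
    (hi : ∀ n, ExtZero.{u} T M (i + 1 + n)) : HasCoresolution (addClosure T) i M := by
  induction i generalizing M with
  | zero =>
    refine ⟨M, hT.addClosure_of_perp K hM (rightPerp_addClosure_iff.2 ⟨hM.1, fun n => ?_⟩),
      ⟨Iso.refl M⟩⟩
    convert hi n using 1
    omega
  | succ i ih =>
    obtain ⟨n, N, f, g, hs, hN⟩ := hT.exists_ses_of_leftPerp K hR hM
    refine ⟨power T n, N, f, g, hs.choose, hs.choose_spec, addClosure_power T n,
      ih hN fun k => hs.extZero_right T ?_ ?_⟩
    · have := (addClosure_power T n).extZero_right (hT.extZero_self (i + k))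
      convert this using 1
      omega
    · convert hi k using 1
      omega

/-- The `i`-th injective cosyzygy of `Y` lies in `T⊥`; this bounds the projective dimension on
`⊥(T⊥)` by that of `T`. -/
theorem leftPerp_rightPerp_extZero {i : ℕ} (hR : EnoughFiniteInjectives R) {M : ModuleCat.{u} R}
    (hM : leftPerp (rightPerp (addClosure T)) M) {Y : ModuleCat.{u} R} (hY : Module.Finite R Y)
    (hTY : ∀ n, ExtZero.{u} T Y (i + 1 + n)) : ∀ n, ExtZero.{u} M Y (i + 1 + n) := by
  induction i generalizing Y with
  | zero =>
    intro n
    have := hM.extZero (rightPerp_addClosure_iff.2 ⟨hY, fun n => by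
      convert hTY n using 1
      omega⟩) n
    convert this using 1
    omega
  | succ i ih =>
    intro n
    obtain ⟨J, N, f, g, hs, hJ, hJfin, hN⟩ := hR.exists_ses Y hY
    have h1 := ih hN (fun n => by
      rw [show i + 1 + n = i + n + 1 by omega]
      refine hs.extZero_right T (.of_injective T J _) ?_
      convert hTY n using 1
      omega) n
    rw [show i + 1 + 1 + n = i + 1 + n + 1 by omega]
    exact hs.extZero_left M h1 (.of_injective M J _)

theorem leftPerp_rightPerp_projectiveDimension_le [IsNoetherianRing R] {i : ℕ} (hR : EnoughFiniteInjectives R)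
    {M : ModuleCat.{u} R} (hM : leftPerp (rightPerp (addClosure T)) M)
    (hi : projectiveDimension T ≤ (i : WithBot ℕ∞)) :
    projectiveDimension M ≤ (i : WithBot ℕ∞) := by
  rw [projectiveDimension_le_iff_extZero] at hi
  exact projectiveDimension_le_of_finite hM.1 fun Y hY =>
    leftPerp_rightPerp_extZero hR hM hY (hi Y) 0

theorem IsTilting.finitelyCoresolved_eq (K : Type u) [Field K] [Algebra K R] [Module.Finite K R]
    [IsNoetherianRing R] (hT : IsTilting T) (hR : EnoughFiniteInjectives R) {i : ℕ}
    (hi : projectiveDimension T ≤ (i : WithBot ℕ∞)) :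
    finitelyCoresolved (addClosure T) = leftPerp (rightPerp (addClosure T)) := by
  ext M
  refine ⟨fun ⟨hfin, n, hn⟩ => leftPerp_of_extZero hfin fun Y hY =>
    hn.extZero_left (rightPerp_addClosure_iff.1 hY).2, fun hM => ⟨hM.1, i, ?_⟩⟩
  exact hT.hasCoresolution K hR hM (projectiveDimension_le_iff_extZero.1 hi M)

end Tilting

/-! ### Cotilting modules: `(⊥T)⊥` and finite `add(T)`-resolutions -/

section Cotilting

variable {R : Type u} [Ring R]
  {T : ModuleCat.{u} R}

variable {J : ModuleCat.{u} R}

theorem IsCotiltingFor.exists_ses_of_leftPerp (K : Type u) [Field K] [Algebra K R] [Module.Finite K R]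
    (hT : IsCotiltingFor J T) {X : ModuleCat.{u} R}
    (hX : leftPerp (addClosure T) X) :
    ∃ (n : ℕ) (X' : ModuleCat.{u} R) (f : X ⟶ power T n) (g : power T n ⟶ X'), IsSES f g ∧
      leftPerp (addClosure T) X' := by
  obtain ⟨hfin, hX⟩ := leftPerp_addClosure_iff.1 hX
  obtain ⟨m, hm⟩ := hT.resolution
  obtain ⟨n, X', f, g, hs, hfin', hX', -⟩ := exists_ses_power_of_separating K hT.finite
    hT.extZero_self hfin hX (separating_of_hasResolution hT.cogenerator hm hfin hX)
  exact ⟨n, X', f, g, hs, leftPerp_addClosure_iff.2 ⟨hfin', hX'⟩⟩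

/-- Dual to `IsTilting.exists_ses_of_leftPerp`: a free module lies in `⊥T` and embeds in a power of
`T` with cokernel in `⊥T`, so a free cover of `M` extends to that power and `T` generates `M`. -/
theorem IsCotiltingFor.exists_ses_of_rightPerp (K : Type u) [Field K] [Algebra K R] [Module.Finite K R]
    [IsNoetherianRing R] (hT : IsCotiltingFor J T)
    {M : ModuleCat.{u} R} (hM : rightPerp (leftPerp (addClosure T)) M) :
    ∃ (n : ℕ) (N : ModuleCat.{u} R) (f : N ⟶ power T n) (g : power T n ⟶ M), IsSES f g ∧
      rightPerp (leftPerp (addClosure T)) N := by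
  have hMT := hM.extZero hT.leftPerp_self
  obtain ⟨n, N, f, g, hs, hN, -, hf⟩ := exists_ses_power_of_generating K hT.finite
    hT.extZero_self hM.1 hMT fun L hL => by
      obtain ⟨m, e, he⟩ := exists_epi_power_regular M hM.1
      obtain ⟨m, Y', a, b, hab, hY'⟩ := hT.exists_ses_of_leftPerp K
        (leftPerp_of_projective (projective_power_regular m) (finite_power finite_regular m) _)
      obtain ⟨l, hl⟩ := hab.exists_desc M (hM.extZero hY' 0) e
      refine eq_top_iff.2 fun y _ => ?_
      obtain ⟨x, rfl⟩ := (ModuleCat.epi_iff_surjective e).1 he y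
      rw [← hl]
      exact (addClosure_power T _).mem_of_forall hL l _
  refine ⟨n, N, f, g, hs, rightPerp_of_extZero hN fun Y hY k => ?_⟩
  have hP := fun k => (addClosure_power T n).extZero_right (hY.extZero (addClosure_self T) k)
  cases k with
  | succ k => exact hs.extZero_left Y (hM.extZero hY k) (hP (k + 1))
  | zero =>
    refine hs.extZero_one_of_lift Y (hP 0) fun k => ?_
    obtain ⟨m, Y', a, b, hab, hY'⟩ := hT.exists_ses_of_leftPerp K hY
    obtain ⟨l, rfl⟩ := hab.exists_desc M (hM.extZero hY' 0) k
    choose t ht using fun j => hf (power.ι T m j ≫ l)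
    refine ⟨a ≫ power.desc t, ?_⟩
    rw [Category.assoc]
    congr 1
    rw [← Category.id_comp l, ← power.total T m, Preadditive.sum_comp]
    rw [← Category.id_comp (power.desc t ≫ g), ← power.total T m, Preadditive.sum_comp]
    refine Finset.sum_congr rfl fun j _ => ?_
    rw [Category.assoc, power.ι_desc_assoc, ht, Category.assoc]

theorem IsCotiltingFor.addClosure_of_perp (K : Type u) [Field K] [Algebra K R] [Module.Finite K R]
    (hT : IsCotiltingFor J T) {M : ModuleCat.{u} R}
    (hM : rightPerp (leftPerp (addClosure T)) M) (hM' : leftPerp (addClosure T) M) :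
    addClosure T M := by
  obtain ⟨n, Y', f, g, hs, hY'⟩ := hT.exists_ses_of_leftPerp K hM'
  obtain ⟨l, hl⟩ := hs.exists_desc M (hM.extZero hY' 0) (𝟙 M)
  exact ⟨n, ⟨⟨f, l, hl⟩⟩⟩

theorem IsCotiltingFor.hasResolution (K : Type u) [Field K] [Algebra K R] [Module.Finite K R]
    [IsNoetherianRing R] (hT : IsCotiltingFor J T) {i : ℕ}
    {M : ModuleCat.{u} R} (hM : rightPerp (leftPerp (addClosure T)) M)
    (hi : ∀ n, ExtZero.{u} M T (i + 1 + n)) : HasResolution (addClosure T) i M := by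
  induction i generalizing M with
  | zero =>
    refine ⟨M, hT.addClosure_of_perp K hM (leftPerp_addClosure_iff.2 ⟨hM.1, fun n => ?_⟩),
      ⟨Iso.refl M⟩⟩
    convert hi n using 1
    omega
  | succ i ih =>
    obtain ⟨n, N, f, g, hs, hN⟩ := hT.exists_ses_of_rightPerp K hM
    refine ⟨N, power T n, f, g, hs.choose, hs.choose_spec, addClosure_power T n,
      ih hN fun k => hs.zeroExt_left T ?_ ?_⟩
    · have := (addClosure_power T n).extZero_left (hT.extZero_self (i + k))
      convert this using 1
      omega
    · convert hi k using 1
      omega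

theorem rightPerp_leftPerp_extZero [IsNoetherianRing R] {i : ℕ} {M : ModuleCat.{u} R}
    (hM : rightPerp (leftPerp (addClosure T)) M) {X : ModuleCat.{u} R} (hX : Module.Finite R X)
    (hXT : ∀ n, ExtZero.{u} X T (i + 1 + n)) : ∀ n, ExtZero.{u} X M (i + 1 + n) := by
  induction i generalizing X with
  | zero =>
    intro n
    have := hM.extZero (leftPerp_addClosure_iff.2 ⟨hX, fun n => by
      convert hXT n using 1
      omega⟩) n
    convert this using 1
    omega
  | succ i ih =>
    intro n
    obtain ⟨N, P, f, g, hs, hN, hP, hPfin⟩ := exists_ses_projective X hX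
    have h1 := ih hN (fun n => by
      rw [show i + 1 + n = i + n + 1 by omega]
      refine hs.zeroExt_left T (.of_projective P T _) ?_
      convert hXT n using 1
      omega) n
    rw [show i + 1 + 1 + n = i + 1 + n + 1 by omega]
    exact hs.zeroExt_right M h1 (.of_projective P M _)

theorem rightPerp_leftPerp_injectiveDimension_le [IsNoetherianRing R] {i : ℕ} (hR : EnoughFiniteInjectives R)
    {M : ModuleCat.{u} R} (hM : rightPerp (leftPerp (addClosure T)) M)
    (hi : injectiveDimension T ≤ (i : WithBot ℕ∞)) :
    injectiveDimension M ≤ (i : WithBot ℕ∞) := by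
  rw [injectiveDimension_le_iff_extZero] at hi
  exact injectiveDimension_le_of_finite hR hM.1 fun Y hY =>
    rightPerp_leftPerp_extZero hM hY (hi Y) 0

theorem IsCotiltingFor.finitelyResolved_eq (K : Type u) [Field K] [Algebra K R] [Module.Finite K R]
    [IsNoetherianRing R] (hT : IsCotiltingFor J T) {i : ℕ}
    (hi : injectiveDimension T ≤ (i : WithBot ℕ∞)) :
    finitelyResolved (addClosure T) = rightPerp (leftPerp (addClosure T)) := by
  ext M
  refine ⟨fun ⟨hfin, n, hn⟩ => rightPerp_of_extZero hfin fun Y hY =>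
    hn.extZero_right (leftPerp_addClosure_iff.1 hY).2, fun hM => ⟨hM.1, i, ?_⟩⟩
  exact hT.hasResolution K hM (injectiveDimension_le_iff_extZero.1 hi M)

end Cotilting

/-! ### The duality `Hom_K(-, K)` -/

section Dual

open scoped ModuleCat

/-- Two `K`-algebras together with an anti-isomorphism between them. -/
structure OppositePair (K R S : Type u) [Field K] [Ring R] [Ring S] [Algebra K R] [Algebra K S]
    where
  equiv : S ≃ₗ[K] R
  map_one : equiv 1 = 1
  map_mul : ∀ a b, equiv (a * b) = equiv b * equiv a

variable {K R S : Type u} [Field K] [Ring R] [Ring S] [Algebra K R] [Algebra K S]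

/-- The anti-isomorphism in the other direction. -/
def OppositePair.symm (p : OppositePair K R S) : OppositePair K S R where
  equiv := p.equiv.symm
  map_one := by rw [LinearEquiv.symm_apply_eq, p.map_one]
  map_mul a b := by rw [LinearEquiv.symm_apply_eq, p.map_mul]; simp

variable (p : OppositePair K R S)

/-- The action of `S` on the dual of an `R`-module. -/
abbrev OppositePair.dualModule (M : ModuleCat.{u} R) : Module S (Module.Dual K M) where
  smul s f := f ∘ₗ Module.toModuleEnd K M (p.equiv s)
  one_smul f := by ext m; exact congrArg f (by rw [p.map_one]; exact one_smul R m)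
  mul_smul a b f := by ext m; exact congrArg f (by rw [p.map_mul]; exact mul_smul _ _ m)
  smul_zero a := rfl
  smul_add a f g := rfl
  add_smul a b f := by
    ext m; exact (congrArg f (by rw [map_add]; exact add_smul _ _ m)).trans (map_add f _ _)
  zero_smul f := by
    ext m; exact (congrArg f (by rw [map_zero]; exact zero_smul R m)).trans (map_zero f)

/-- The dual of an `R`-module, as an `S`-module. -/
def OppositePair.dual (M : ModuleCat.{u} R) : ModuleCat.{u} S :=
  letI := p.dualModule M
  ModuleCat.of S (Module.Dual K M)

variable {p}

/-- An element of the dual module as a functional. -/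
def OppositePair.toDual {M : ModuleCat.{u} R} (φ : p.dual M) : Module.Dual K M := φ

variable (p) in
/-- A functional as an element of the dual module. -/
def OppositePair.ofDual {M : ModuleCat.{u} R} (φ : Module.Dual K M) : p.dual M := φ

/-- The pairing of the dual module with the module. -/
def OppositePair.pairing {M : ModuleCat.{u} R} (φ : p.dual M) (m : M) : K := toDual φ m

open OppositePair

@[ext]
theorem OppositePair.pairing_ext {M : ModuleCat.{u} R} {φ ψ : p.dual M}
    (h : ∀ m, pairing φ m = pairing ψ m) : φ = ψ :=
  LinearMap.ext (f := toDual φ) (g := toDual ψ) h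

theorem OppositePair.pairing_add {M : ModuleCat.{u} R} (φ ψ : p.dual M) (m : M) :
    pairing (φ + ψ) m = pairing φ m + pairing ψ m := rfl

theorem OppositePair.pairing_smul {M : ModuleCat.{u} R} (s : S) (φ : p.dual M) (m : M) :
    pairing (s • φ) m = pairing φ (p.equiv s • m) := rfl

theorem OppositePair.pairing_map_add {M : ModuleCat.{u} R} (φ : p.dual M) (m n : M) :
    pairing φ (m + n) = pairing φ m + pairing φ n := map_add (toDual φ) m n

theorem OppositePair.pairing_map_zero {M : ModuleCat.{u} R} (φ : p.dual M) :
    pairing φ 0 = 0 := map_zero (toDual φ)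

theorem OppositePair.pairing_map_smul {M : ModuleCat.{u} R} (φ : p.dual M) (k : K) (m : M) :
    pairing φ (k • m) = k * pairing φ m := map_smul (toDual φ) k m

theorem OppositePair.equiv_algebraMap (k : K) : p.equiv (algebraMap K S k) = algebraMap K R k := by
  rw [Algebra.algebraMap_eq_smul_one, map_smul, p.map_one, Algebra.algebraMap_eq_smul_one]

theorem OppositePair.pairing_smul_field {M : ModuleCat.{u} R} (k : K) (φ : p.dual M) (m : M) :
    pairing (k • φ) m = k * pairing φ m := by
  have h : pairing (algebraMap K S k • φ) m = pairing φ (algebraMap K R k • m) := by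
    rw [pairing_smul, equiv_algebraMap]
  exact h.trans (pairing_map_smul φ k m)

theorem hom_smul_field {M N : ModuleCat.{u} R} (f : M ⟶ N) (k : K) (m : M) :
    f.hom (k • m) = k • f.hom m :=
  map_smul f.hom (algebraMap K R k) m

theorem OppositePair.eq_zero_of_forall_pairing {M : ModuleCat.{u} R} {m : M}
    (h : ∀ φ : p.dual M, pairing φ m = 0) : m = 0 :=
  (Module.forall_dual_apply_eq_zero_iff K m).1 fun φ => h (p.ofDual φ)

variable (p) in
/-- The transpose of a map of modules. -/
def OppositePair.dualMap {M N : ModuleCat.{u} R} (f : M ⟶ N) : p.dual N ⟶ p.dual M :=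
  ModuleCat.ofHom (X := p.dual N) (Y := p.dual M)
    { toFun := fun φ => p.ofDual (toDual φ ∘ₗ f.hom.restrictScalars K)
      map_add' := fun _ _ => rfl
      map_smul' := fun s φ => pairing_ext fun m =>
        congrArg (pairing φ) (map_smul f.hom (p.equiv s) m).symm }

theorem OppositePair.dualMap_id (M : ModuleCat.{u} R) : p.dualMap (𝟙 M) = 𝟙 _ := rfl

theorem OppositePair.dualMap_comp {M N L : ModuleCat.{u} R} (f : M ⟶ N) (g : N ⟶ L) :
    p.dualMap (f ≫ g) = p.dualMap g ≫ p.dualMap f := rfl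

theorem OppositePair.epi_dualMap {M N : ModuleCat.{u} R} (f : M ⟶ N) [Mono f] :
    Epi (p.dualMap f) := by
  rw [ModuleCat.epi_iff_surjective]
  exact LinearMap.dualMap_surjective_of_injective (f := f.hom.restrictScalars K)
    ((ModuleCat.mono_iff_injective f).1 inferInstance)

theorem OppositePair.mono_dualMap {M N : ModuleCat.{u} R} (f : M ⟶ N) [Epi f] :
    Mono (p.dualMap f) := by
  rw [ModuleCat.mono_iff_injective]
  exact LinearMap.dualMap_injective_of_surjective (f := f.hom.restrictScalars K)
    ((ModuleCat.epi_iff_surjective f).1 inferInstance)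

variable (p) in
theorem IsSES.dual {X Y Z : ModuleCat.{u} R} {f : X ⟶ Y} {g : Y ⟶ Z} (h : IsSES f g) :
    IsSES (p.dualMap g) (p.dualMap f) := by
  have hf := h.mono
  have hg := h.epi
  have h1 := p.epi_dualMap f
  have h2 := p.mono_dualMap g
  obtain ⟨w, hS⟩ := h
  refine ⟨?_, { exact := ?_ }⟩
  · rw [← dualMap_comp, w]
    ext φ m
    exact pairing_map_zero φ
  · rw [ShortComplex.moduleCat_exact_iff]
    intro φ hφ
    -- A functional killed by the transpose of `f` vanishes on the image of `f`, which is the kernel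
    -- of `g`, so it factors through `g`.
    have h3 : toDual φ ∈ (LinearMap.ker (g.hom.restrictScalars K)).dualAnnihilator := by
      rw [Submodule.mem_dualAnnihilator]
      intro y hy
      obtain ⟨x, rfl⟩ := (ShortComplex.moduleCat_exact_iff _).1 hS.exact y hy
      exact congrArg (pairing · x) hφ
    rw [← LinearMap.range_dualMap_eq_dualAnnihilator_ker] at h3
    obtain ⟨ψ, hψ⟩ := h3
    exact ⟨p.ofDual ψ, hψ⟩

/-- The adjunction isomorphism `Hom(X, D P) ≅ Hom(P, D X)`. -/
def OppositePair.transpose {P : ModuleCat.{u} R} {X : ModuleCat.{u} S} (f : X ⟶ p.dual P) :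
    P ⟶ p.symm.dual X :=
  ModuleCat.ofHom (X := P) (Y := p.symm.dual X)
    { toFun := fun q => p.symm.ofDual
        { toFun := fun x => pairing (f.hom x) q
          map_add' := fun x y => by rw [map_add, pairing_add]
          map_smul' := fun k x => by
            rw [hom_smul_field, pairing_smul_field, RingHom.id_apply, smul_eq_mul] }
      map_add' := fun a b => pairing_ext fun x => pairing_map_add (f.hom x) a b
      map_smul' := fun r q => pairing_ext fun x => by
        change pairing (f.hom x) (r • q) = pairing (f.hom (p.symm.equiv r • x)) q
        rw [map_smul, pairing_smul]
        congr 2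
        exact (p.equiv.apply_symm_apply r).symm }

/-- By transposition, extending a map into the dual of `P` along a mono is lifting a map from `P`
along the dual epi. -/
theorem OppositePair.injective_dual (P : ModuleCat.{u} R) [Projective P] :
    Injective (p.dual P) := by
  refine ⟨fun {X Y} g f hf => ?_⟩
  have := p.symm.epi_dualMap f
  let l : P ⟶ p.symm.dual Y := Projective.factorThru (transpose g) (p.symm.dualMap f)
  have hl : l ≫ p.symm.dualMap f = transpose g := Projective.factorThru_comp _ _
  refine ⟨transpose (p := p.symm) l, ?_⟩
  ext x q
  exact congrArg (fun k => pairing (k.hom q) x) hl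

variable (p) in
/-- The evaluation map into the double dual. -/
def OppositePair.eval (M : ModuleCat.{u} R) : M ⟶ p.symm.dual (p.dual M) := transpose (𝟙 _)

theorem OppositePair.mono_transpose {P : ModuleCat.{u} R} {X : ModuleCat.{u} S} (f : X ⟶ p.dual P)
    [Epi f] : Mono (transpose f) := by
  refine (ModuleCat.mono_iff_injective _).2 ((injective_iff_map_eq_zero _).2 fun x hx => ?_)
  refine eq_zero_of_forall_pairing fun φ : p.dual P => ?_
  obtain ⟨y, rfl⟩ := (ModuleCat.epi_iff_surjective f).1 inferInstance φ
  exact congrArg (pairing · y) hx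

theorem OppositePair.isCogenerator_dual : IsCogenerator (p.dual (regular R)) := by
  intro X _ x hx
  refine eq_zero_of_forall_pairing fun φ : p.symm.dual X => ?_
  let g : regular R ⟶ p.symm.dual X :=
    ModuleCat.ofHom (X := regular R) (Y := p.symm.dual X) (LinearMap.toSpanSingleton R _ φ)
  have h1 : pairing (g.hom (1 : R)) x = 0 :=
    congrArg (fun ψ : p.dual (regular R) => pairing ψ (1 : R)) (hx (transpose (p := p.symm) g))
  have h2 : g.hom (1 : R) = φ := LinearMap.toSpanSingleton_apply_one R (p.symm.dual X) φ
  rwa [h2] at h1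

variable [Module.Finite K R]

theorem OppositePair.isIso_eval (M : ModuleCat.{u} R) (hM : Module.Finite R M) :
    IsIso (p.eval M) := by
  have : Module.Finite K M := Module.Finite.trans R M
  refine (ConcreteCategory.isIso_iff_bijective _).2 ⟨(injective_iff_map_eq_zero (p.eval M).hom).2
    fun x hx => eq_zero_of_forall_pairing fun ψ : p.dual M => congrArg (pairing · ψ) hx, fun φ => ?_⟩
  let φ' : Module.Dual K (Module.Dual K M) :=
    { toFun := fun ψ => pairing φ (p.ofDual ψ)
      map_add' := fun a b => pairing_map_add φ (p.ofDual a) (p.ofDual b)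
      map_smul' := fun k a => by
        rw [RingHom.id_apply, smul_eq_mul, ← pairing_map_smul]
        congr 1
        exact (pairing_ext fun m => pairing_smul_field k (p.ofDual a) m).symm }
  obtain ⟨x, hx⟩ := (Module.evalEquiv K M).bijective.2 φ'
  exact ⟨x, pairing_ext fun ψ => LinearMap.congr_fun hx (toDual ψ)⟩

theorem OppositePair.finite_dual (M : ModuleCat.{u} R) (hM : Module.Finite R M) :
    Module.Finite S (p.dual M) := by
  have : Module.Finite K M := Module.Finite.trans R M
  let φ : Module.Dual K M →ₗ[K] p.dual M :=
    { toFun := p.ofDual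
      map_add' := fun _ _ => rfl
      map_smul' := fun k a => (pairing_ext fun m => pairing_smul_field k (p.ofDual a) m).symm }
  have : Module.Finite K (p.dual M) := Module.Finite.of_surjective φ fun x => ⟨toDual x, rfl⟩
  exact Module.Finite.of_restrictScalars_finite K S _

/-- A free cover of the dual of `I` transposes to an embedding of `I` into the dual of a free
module, which splits. Dualizing back makes the dual of `I` a summand of a free module, by
reflexivity. -/
theorem OppositePair.projective_dual [Module.Finite K S] (I : ModuleCat.{u} R) (hI : Injective I)
    (hfin : Module.Finite R I) : Projective (p.dual I) := by
  obtain ⟨n, f, hf⟩ := exists_epi_power_regular (p.dual I) (p.finite_dual I hfin)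
  have := mono_transpose f
  let e : power (regular S) n ⟶ p.dual (p.symm.dual (power (regular S) n)) := p.symm.eval _
  have : IsIso e := p.symm.isIso_eval (power (regular S) n) (finite_power finite_regular n)
  let r := Injective.factorThru (𝟙 I) (transpose f)
  have hr : transpose f ≫ r = 𝟙 I := Injective.comp_factorThru _ _
  -- The triangle identity of the self-adjunction of the duality.
  have key : e ≫ p.dualMap (transpose f) = f := rfl
  refine (Retract.mk (p.dualMap r ≫ inv e) f ?_).projective
  have h1 : p.dualMap r ≫ p.dualMap (transpose f) = 𝟙 _ := by
    rw [← dualMap_comp, hr, dualMap_id]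
  rw [Category.assoc, ← h1]
  congr 1
  rw [IsIso.inv_comp_eq]
  exact key.symm

end Dual

/-! ### Splicing short exact sequences into complexes -/

section Splicing

variable {R : Type u} [Ring R]

theorem IsSES.injective {X Y Z : ModuleCat.{u} R} {f : X ⟶ Y} {g : Y ⟶ Z} (h : IsSES f g) :
    Function.Injective f.hom := (ModuleCat.mono_iff_injective f).1 h.mono

theorem IsSES.surjective {X Y Z : ModuleCat.{u} R} {f : X ⟶ Y} {g : Y ⟶ Z} (h : IsSES f g) :
    Function.Surjective g.hom := (ModuleCat.epi_iff_surjective g).1 h.epi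

theorem IsSES.range_eq_ker {X Y Z : ModuleCat.{u} R} {f : X ⟶ Y} {g : Y ⟶ Z} (h : IsSES f g) :
    LinearMap.range f.hom = LinearMap.ker g.hom :=
  h.choose_spec.exact.moduleCat_range_eq_ker

theorem IsSES.of_linearMap {X Y Z : ModuleCat.{u} R} {f : X ⟶ Y} {g : Y ⟶ Z}
    (hf : Function.Injective f.hom) (hg : Function.Surjective g.hom)
    (h : LinearMap.range f.hom = LinearMap.ker g.hom) : IsSES f g :=
  have w : f ≫ g = 0 := by
    ext x
    have : f.hom x ∈ LinearMap.ker g.hom := h ▸ LinearMap.mem_range_self f.hom x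
    exact this
  have := (ModuleCat.mono_iff_injective f).2 hf
  have := (ModuleCat.epi_iff_surjective g).2 hg
  ⟨w, { exact := (ShortComplex.moduleCat_exact_iff_range_eq_ker _).2 h }⟩

variable {α : Type} [AddRightCancelSemigroup α] [One α] [DecidableEq α] {M E : α → ModuleCat.{u} R}
  {f : ∀ n, M n ⟶ E n} {g : ∀ n, E n ⟶ M (n + 1)}

/-- The complex obtained by splicing short exact sequences. -/
def splice (h : ∀ n, IsSES (f n) (g n)) : CochainComplex (ModuleCat.{u} R) α :=
  CochainComplex.of E (fun n => g n ≫ f (n + 1)) fun n => by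
    rw [Category.assoc, ← Category.assoc (f (n + 1)), (h (n + 1)).choose, zero_comp, comp_zero]

theorem splice_d (h : ∀ n, IsSES (f n) (g n)) (n : α) :
    (splice h).d n (n + 1) = g n ≫ f (n + 1) :=
  CochainComplex.of_d E (fun n => g n ≫ f (n + 1)) n

theorem splice_ker_d (h : ∀ n, IsSES (f n) (g n)) (n : α) :
    LinearMap.ker ((splice h).d n (n + 1)).hom = LinearMap.range (f n).hom := by
  rw [splice_d, (h n).range_eq_ker]
  ext x
  exact (injective_iff_map_eq_zero' _).1 (h (n + 1)).injective _

theorem splice_exact (h : ∀ n, IsSES (f n) (g n)) (n : α) :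
    (ShortComplex.mk _ _ ((splice h).d_comp_d n (n + 1) (n + 1 + 1))).Exact := by
  rw [ShortComplex.moduleCat_exact_iff_range_eq_ker]
  refine Eq.trans ?_ (splice_ker_d h (n + 1)).symm
  refine Eq.trans (congrArg (fun k => LinearMap.range (ModuleCat.Hom.hom k)) (splice_d h n)) ?_
  exact LinearMap.range_comp_of_range_eq_top _ (LinearMap.range_eq_top.2 (h n).surjective)

theorem splice_f_d (h : ∀ n, IsSES (f n) (g n)) (n : α) :
    (show M n ⟶ (splice h).X n from f n) ≫ (splice h).d n (n + 1) = 0 := by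
  refine Eq.trans (congrArg (f n ≫ ·) (splice_d h n)) ?_
  exact (Category.assoc _ _ _).symm.trans ((congrArg (· ≫ f (n + 1)) (h n).choose).trans zero_comp)

end Splicing

/-! ### Injective resolutions by splicing -/

section Resolution

variable {R : Type u} [Ring R] {M E : ℕ → ModuleCat.{u} R}
  {f : ∀ n, M n ⟶ E n} {g : ∀ n, E n ⟶ M (n + 1)}

/-- The injective resolution obtained by splicing short exact sequences. -/
def spliceResolution (h : ∀ n, IsSES (f n) (g n)) (hE : ∀ n, Injective (E n)) :
    InjectiveResolution (M 0) where
  cocomplex := splice h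
  injective := hE
  ι := (CochainComplex.fromSingle₀Equiv _ _).symm ⟨f 0, splice_f_d h 0⟩
  quasiIso := ⟨fun n => by
    cases n with
    | zero =>
      rw [CochainComplex.quasiIsoAt₀_iff, ShortComplex.quasiIso_iff_of_zeros]
      · have h0 : (ShortComplex.mk (X₁ := M 0) (X₂ := (splice h).X 0) (f 0) ((splice h).d 0 (0 + 1))
            (splice_f_d h 0)).Exact := by
          rw [ShortComplex.moduleCat_exact_iff_range_eq_ker]
          exact (splice_ker_d h 0).symm
        refine (ShortComplex.exact_and_mono_f_iff_of_iso ?_).2 ⟨h0, (h 0).mono⟩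
        exact ShortComplex.isoMk (Iso.refl _) (Iso.refl _) (Iso.refl _)
          ((Category.id_comp _).trans ((Category.comp_id _).trans
            (CochainComplex.fromSingle₀Equiv_symm_apply_f_zero (C := splice h) (f 0) _)).symm)
          ((Category.id_comp _).trans (Category.comp_id _).symm)
      all_goals rfl
    | succ n =>
      rw [quasiIsoAt_iff_exactAt]
      · rw [HomologicalComplex.exactAt_iff' _ n (n + 1) (n + 1 + 1) (by simp) (by simp)]
        exact splice_exact h n
      · apply CochainComplex.exactAt_succ_single_obj⟩

end Resolution

/-! ### Projective-injective modules and torsion -/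

section ProjInj

variable {R : Type u} [Ring R]

/-- The finitely generated projective-injective modules. -/
structure IsProjInj (Q : ModuleCat.{u} R) : Prop where
  projective : Projective Q
  injective : Injective Q
  finite : Module.Finite R Q

theorem finite_biprod {M N : ModuleCat.{u} R} (hM : Module.Finite R M) (hN : Module.Finite R N) :
    Module.Finite R (M ⊞ N : ModuleCat.{u} R) :=
  finite_of_iso (ModuleCat.biprodIsoProd M N).symm (inferInstanceAs (Module.Finite R (M × N)))

theorem isProjInj_biprod {P Q : ModuleCat.{u} R} (hP : IsProjInj P) (hQ : IsProjInj Q) :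
    IsProjInj (P ⊞ Q) :=
  have := hP.projective
  have := hQ.projective
  have := hP.injective
  have := hQ.injective
  ⟨inferInstance, inferInstance, finite_biprod hP.finite hQ.finite⟩

theorem IsProjInj.retract {P Q : ModuleCat.{u} R} (hQ : IsProjInj Q) (r : Retract P Q) :
    IsProjInj P :=
  have := hQ.projective
  have := hQ.injective
  ⟨r.projective, r.injective, finite_of_retract r hQ.finite⟩

theorem isProjInj_punit : IsProjInj (ModuleCat.of R PUnit.{u + 1}) :=
  have h : IsZero (ModuleCat.of R PUnit.{u + 1}) := ModuleCat.isZero_of_subsingleton _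
  ⟨h.projective, h.injective, inferInstanceAs (Module.Finite R PUnit.{u + 1})⟩

/-- There is an exact sequence `0 → M → Q_0 → ⋯ → Q_{m-1}` with projective-injective terms. -/
def HasProjInjCopresentation : ℕ → ModuleCat.{u} R → Prop
  | 0, _ => True
  | m + 1, M => ∃ (Q N : ModuleCat.{u} R) (f : M ⟶ Q) (g : Q ⟶ N), IsSES f g ∧ IsProjInj Q ∧
      HasProjInjCopresentation m N

/-- There is an exact sequence `Q_{m-1} → ⋯ → Q_0 → M → 0` with projective-injective terms. -/
def HasProjInjPresentation : ℕ → ModuleCat.{u} R → Prop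
  | 0, _ => True
  | m + 1, M => ∃ (N Q : ModuleCat.{u} R) (f : N ⟶ Q) (g : Q ⟶ M), IsSES f g ∧ IsProjInj Q ∧
      HasProjInjPresentation m N

theorem IsSES.of_iso_left {X X' Y Z : ModuleCat.{u} R} {f : X ⟶ Y} {g : Y ⟶ Z} (h : IsSES f g)
    (e : X' ≅ X) : IsSES (e.hom ≫ f) g := by
  obtain ⟨w, hS⟩ := h
  refine ⟨by rw [Category.assoc, w, comp_zero], ShortComplex.shortExact_of_iso
    (S₁ := ShortComplex.mk f g w)
    (ShortComplex.isoMk e.symm (Iso.refl _) (Iso.refl _) ?_ ?_) hS⟩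
  · simp
  · simp

theorem IsSES.of_iso_right {X Y Z Z' : ModuleCat.{u} R} {f : X ⟶ Y} {g : Y ⟶ Z} (h : IsSES f g)
    (e : Z ≅ Z') : IsSES f (g ≫ e.hom) := by
  obtain ⟨w, hS⟩ := h
  refine ⟨by rw [← Category.assoc, w, zero_comp], ShortComplex.shortExact_of_iso
    (S₁ := ShortComplex.mk f g w) (ShortComplex.isoMk (Iso.refl _) (Iso.refl _) e ?_ ?_) hS⟩
  · simp
  · simp

theorem HasProjInjCopresentation.of_iso {m : ℕ} {M M' : ModuleCat.{u} R}
    (h : HasProjInjCopresentation m M) (e : M' ≅ M) : HasProjInjCopresentation m M' := by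
  cases m with
  | zero => trivial
  | succ m =>
    obtain ⟨Q, N, f, g, hs, hQ, hN⟩ := h
    exact ⟨Q, N, _, g, hs.of_iso_left e, hQ, hN⟩

theorem HasProjInjPresentation.of_iso {m : ℕ} {M M' : ModuleCat.{u} R}
    (h : HasProjInjPresentation m M) (e : M ≅ M') : HasProjInjPresentation m M' := by
  cases m with
  | zero => trivial
  | succ m =>
    obtain ⟨N, Q, f, g, hs, hQ, hN⟩ := h
    exact ⟨N, Q, f, _, hs.of_iso_right e, hQ, hN⟩

/-- The finitely generated modules without nonzero maps to projective-injective modules. -/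
def IsLeftTorsion (Z : ModuleCat.{u} R) : Prop :=
  Module.Finite R Z ∧ ∀ Q : ModuleCat.{u} R, IsProjInj Q → ExtZero.{u} Z Q 0

/-- The finitely generated modules without nonzero maps from projective-injective modules. -/
def IsRightTorsion (Z : ModuleCat.{u} R) : Prop :=
  Module.Finite R Z ∧ ∀ Q : ModuleCat.{u} R, IsProjInj Q → ExtZero.{u} Q Z 0

theorem IsLeftTorsion.extZero {Z Q : ModuleCat.{u} R} (hZ : IsLeftTorsion Z) (hQ : IsProjInj Q)
    (n : ℕ) : ExtZero.{u} Z Q n := by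
  cases n with
  | zero => exact hZ.2 Q hQ
  | succ n => exact have := hQ.injective; .of_injective Z Q n

theorem IsRightTorsion.extZero {Z Q : ModuleCat.{u} R} (hZ : IsRightTorsion Z) (hQ : IsProjInj Q)
    (n : ℕ) : ExtZero.{u} Q Z n := by
  cases n with
  | zero => exact hZ.2 Q hQ
  | succ n => exact have := hQ.projective; .of_projective Q Z n

theorem HasProjInjCopresentation.extZero {m : ℕ} {M : ModuleCat.{u} R}
    (h : HasProjInjCopresentation m M) {Z : ModuleCat.{u} R} (hZ : IsLeftTorsion Z) :
    ∀ j < m, ExtZero.{u} Z M j := by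
  induction m generalizing M with
  | zero => intro j hj; omega
  | succ m ih =>
    obtain ⟨Q, N, f, g, hs, hQ, hN⟩ := h
    intro j hj
    cases j with
    | zero => exact hs.extZero_left_zero Z (hZ.extZero hQ 0)
    | succ j => exact hs.extZero_left Z (ih hN j (by omega)) (hZ.extZero hQ _)

/-- Dimension shifting along a copresentation by projective-injectives. -/
theorem HasProjInjCopresentation.extZero_of_injectiveDimension {m : ℕ} {M T : ModuleCat.{u} R}
    (h : HasProjInjCopresentation m M) {n : ℕ}
    (hT : ∀ Z : ModuleCat.{u} R, ExtZero.{u} Z T (n + 1 + m)) : ExtZero.{u} M T (n + 1) := by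
  induction m generalizing M n with
  | zero => exact hT M
  | succ m ih =>
    obtain ⟨Q, N, f, g, hs, hQ, hN⟩ := h
    have := hQ.projective
    refine hs.zeroExt_left T (.of_projective Q T n) (ih hN (n := n + 1) fun Z => ?_)
    convert hT Z using 1
    omega

theorem HasProjInjPresentation.extZero_of_projectiveDimension {m : ℕ} {M T : ModuleCat.{u} R}
    (h : HasProjInjPresentation m M) {n : ℕ}
    (hT : ∀ Z : ModuleCat.{u} R, ExtZero.{u} T Z (n + 1 + m)) : ExtZero.{u} T M (n + 1) := by
  induction m generalizing M n with
  | zero => exact hT M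
  | succ m ih =>
    obtain ⟨N, Q, f, g, hs, hQ, hN⟩ := h
    have := hQ.injective
    refine hs.extZero_right T (.of_injective T Q n) (ih hN (n := n + 1) fun Z => ?_)
    convert hT Z using 1
    omega

/-- Take a map from `M` to a member of `D` with minimal kernel. Any map from that kernel to a member
of `D` extends to `M` by injectivity; adjoining it cannot shrink the kernel, so it was zero. The
hypothesis then makes the inclusion of the kernel in `M` zero. -/
theorem exists_mono_of_separating [IsArtinianRing R] {D : ModuleCat.{u} R → Prop}
    (h0 : ∃ Q, D Q) (hinj : ∀ Q, D Q → Injective Q) (hadd : ∀ P Q, D P → D Q → D (P ⊞ Q))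
    {M : ModuleCat.{u} R} (hM : Module.Finite R M)
    (h : ∀ Z : ModuleCat.{u} R, Module.Finite R Z → (∀ Q, D Q → ExtZero.{u} Z Q 0) →
      ExtZero.{u} Z M 0) :
    ∃ (Q : ModuleCat.{u} R) (f : M ⟶ Q), D Q ∧ Mono f := by
  obtain ⟨Q₀, hQ₀⟩ := h0
  let S : Set (Submodule R M) := {L | ∃ (Q : ModuleCat.{u} R) (f : M ⟶ Q), D Q ∧
    LinearMap.ker f.hom = L}
  obtain ⟨L, ⟨Q, f, hQ, rfl⟩, hmin⟩ := IsArtinian.set_has_minimal S ⟨_, Q₀, 0, hQ₀, rfl⟩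
  have hfin : Module.Finite R (LinearMap.ker f.hom) := inferInstance
  let ι : ModuleCat.of R (LinearMap.ker f.hom) ⟶ M := ModuleCat.ofHom (Submodule.subtype _)
  have hι : Mono ι := (ModuleCat.mono_iff_injective ι).2 Subtype.val_injective
  have key := h (ModuleCat.of R (LinearMap.ker f.hom)) hfin fun Q' hQ' => by
    rw [extZero_zero_iff]
    intro k
    have := hinj Q' hQ'
    obtain ⟨l, rfl⟩ : ∃ l : M ⟶ Q', ι ≫ l = k :=
      ⟨Injective.factorThru k ι, Injective.comp_factorThru k ι⟩
    have h1 : LinearMap.ker (biprod.lift f l).hom ≤ LinearMap.ker f.hom := by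
      intro x hx
      have : ((biprod.lift f l) ≫ biprod.fst).hom x = 0 :=
        (congrArg (biprod.fst : Q ⊞ Q' ⟶ Q).hom hx).trans (map_zero _)
      rwa [biprod.lift_fst] at this
    have h2 : LinearMap.ker (biprod.lift f l).hom ≤ LinearMap.ker l.hom := by
      intro x hx
      have : ((biprod.lift f l) ≫ biprod.snd).hom x = 0 :=
        (congrArg (biprod.snd : Q ⊞ Q' ⟶ Q').hom hx).trans (map_zero _)
      rwa [biprod.lift_snd] at this
    have h3 : LinearMap.ker f.hom ≤ LinearMap.ker (biprod.lift f l).hom := by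
      by_contra hlt
      exact hmin _ ⟨_, biprod.lift f l, hadd _ _ hQ hQ', rfl⟩ (lt_of_le_not_ge h1 hlt)
    ext x
    exact h2 (h3 x.2)
  refine ⟨Q, f, hQ, (ModuleCat.mono_iff_injective f).2 ((injective_iff_map_eq_zero _).2 ?_)⟩
  intro x hx
  have h4 := extZero_zero_iff.1 key ι
  exact congrArg (fun k : ModuleCat.of R (LinearMap.ker f.hom) ⟶ M =>
    k.hom (⟨x, hx⟩ : LinearMap.ker f.hom)) h4

theorem exists_epi_of_generating [IsNoetherianRing R] {D : ModuleCat.{u} R → Prop}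
    (h0 : ∃ Q, D Q) (hproj : ∀ Q, D Q → Projective Q) (hadd : ∀ P Q, D P → D Q → D (P ⊞ Q))
    {M : ModuleCat.{u} R} (hM : Module.Finite R M)
    (h : ∀ Z : ModuleCat.{u} R, Module.Finite R Z → (∀ Q, D Q → ExtZero.{u} Q Z 0) →
      ExtZero.{u} M Z 0) :
    ∃ (Q : ModuleCat.{u} R) (f : Q ⟶ M), D Q ∧ Epi f := by
  obtain ⟨Q₀, hQ₀⟩ := h0
  let S : Set (Submodule R M) := {L | ∃ (Q : ModuleCat.{u} R) (f : Q ⟶ M), D Q ∧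
    LinearMap.range f.hom = L}
  obtain ⟨L, ⟨Q, f, hQ, rfl⟩, hmax⟩ := set_has_maximal_iff_noetherian.2
    (inferInstanceAs (IsNoetherian R M)) S ⟨_, Q₀, 0, hQ₀, rfl⟩
  let π : M ⟶ ModuleCat.of R (M ⧸ LinearMap.range f.hom) := ModuleCat.ofHom (Submodule.mkQ _)
  have hπ : Epi π := (ModuleCat.epi_iff_surjective π).2 (Submodule.mkQ_surjective _)
  have key := h (ModuleCat.of R (M ⧸ LinearMap.range f.hom)) (finite_of_epi π hM) fun Q' hQ' => by
    rw [extZero_zero_iff]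
    intro k
    have := hproj Q' hQ'
    obtain ⟨l, rfl⟩ : ∃ l : Q' ⟶ M, l ≫ π = k :=
      ⟨Projective.factorThru k π, Projective.factorThru_comp k π⟩
    have h1 : LinearMap.range f.hom ≤ LinearMap.range (biprod.desc f l).hom := by
      rintro _ ⟨x, rfl⟩
      refine ⟨(biprod.inl : Q ⟶ Q ⊞ Q').hom x, ?_⟩
      exact congrArg (fun k : Q ⟶ M => k.hom x) (biprod.inl_desc f l)
    have h2 : LinearMap.range l.hom ≤ LinearMap.range (biprod.desc f l).hom := by
      rintro _ ⟨x, rfl⟩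
      refine ⟨(biprod.inr : Q' ⟶ Q ⊞ Q').hom x, ?_⟩
      exact congrArg (fun k : Q' ⟶ M => k.hom x) (biprod.inr_desc f l)
    have h3 : LinearMap.range (biprod.desc f l).hom ≤ LinearMap.range f.hom := by
      by_contra hlt
      exact hmax _ ⟨_, biprod.desc f l, hadd _ _ hQ hQ', rfl⟩ (lt_of_le_not_ge h1 hlt)
    ext x
    exact (Submodule.Quotient.mk_eq_zero _).2 (h3 (h2 ⟨x, rfl⟩))
  refine ⟨Q, f, hQ, (ModuleCat.epi_iff_range_eq_top f).2 (eq_top_iff.2 fun x _ => ?_)⟩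
  have h4 := extZero_zero_iff.1 key π
  exact (Submodule.Quotient.mk_eq_zero _).1 (congrArg (fun k : M ⟶ _ => k.hom x) h4)

/-- Degree zero yields a projective-injective cover of `M`. Right torsion modules have no Ext from
the covering module in any degree, so its kernel inherits the vanishing with one degree fewer. -/
theorem hasProjInjPresentation_of_extZero [IsNoetherianRing R] {m : ℕ} {M : ModuleCat.{u} R}
    (hM : Module.Finite R M)
    (h : ∀ Z : ModuleCat.{u} R, IsRightTorsion Z → ∀ j < m, ExtZero.{u} M Z j) :
    HasProjInjPresentation m M := by
  induction m generalizing M with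
  | zero => trivial
  | succ m ih =>
    obtain ⟨Q, g, hQ, hg⟩ := exists_epi_of_generating ⟨_, isProjInj_punit⟩
      (fun Q hQ => hQ.projective) (fun P Q => isProjInj_biprod) hM
      fun Z hZ hZ' => h Z ⟨hZ, hZ'⟩ 0 (by omega)
    have hs := IsSES.of_epi g
    refine ⟨_, Q, _, g, hs, hQ, ih (hs.finite_left hQ.finite) fun Z hZ j hj => ?_⟩
    exact hs.zeroExt_left Z (hZ.extZero hQ j) (h Z hZ (j + 1) (by omega))

end ProjInj

/-! ### Injective hulls -/

section Hull

variable {R : Type u} [Ring R] [IsArtinianRing R]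

/-- An injective hull inside a finitely generated injective module. -/
theorem exists_essential_retract {M I : ModuleCat.{u} R} (f : M ⟶ I) [Mono f] [Injective I]
    (hI : Module.Finite R I) :
    ∃ (E : ModuleCat.{u} R) (g : M ⟶ E), Nonempty (Retract E I) ∧ Mono g ∧
      IsEssentialSubmodule (LinearMap.range g.hom) := by
  let S : Set (Submodule R I) := {L | ∃ φ : I ⟶ I, f ≫ φ = f ∧ LinearMap.range φ.hom = L}
  -- The hull is the smallest image of an endomorphism of `I` fixing `M`. Minimality makes every
  -- endomorphism of it fixing `M` bijective up to the automorphism `i ≫ q`.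
  obtain ⟨L, ⟨φ, hφ, rfl⟩, hmin⟩ := IsArtinian.set_has_minimal S ⟨_, 𝟙 I, Category.comp_id f, rfl⟩
  have hmin' : ∀ ψ : I ⟶ I, f ≫ ψ = f → LinearMap.range (ψ ≫ φ).hom = LinearMap.range φ.hom := by
    intro ψ hψ
    have hle : LinearMap.range (ψ ≫ φ).hom ≤ LinearMap.range φ.hom := by
      rintro _ ⟨x, rfl⟩
      exact ⟨ψ.hom x, rfl⟩
    by_contra hne
    exact hmin _ ⟨ψ ≫ φ, by rw [← Category.assoc, hψ, hφ], rfl⟩ (lt_of_le_of_ne hle hne)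
  let E : ModuleCat.{u} R := ModuleCat.of R (LinearMap.range φ.hom)
  have hEfin : Module.Finite R E := inferInstanceAs (Module.Finite R (LinearMap.range φ.hom))
  let i : E ⟶ I := ModuleCat.ofHom (Submodule.subtype _)
  let q : I ⟶ E := ModuleCat.ofHom φ.hom.rangeRestrict
  have hqi : q ≫ i = φ := rfl
  have hbij : ∀ χ : E ⟶ E, (f ≫ q) ≫ χ = f ≫ q → Function.Bijective (χ ≫ i ≫ q).hom := by
    intro χ hχ
    have hr := hmin' (q ≫ χ ≫ i) (by
      rw [← Category.assoc, ← Category.assoc, hχ, Category.assoc, hqi, hφ])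
    have hsurj : Function.Surjective (χ ≫ i ≫ q).hom := by
      intro e
      have he : e.1 ∈ LinearMap.range ((q ≫ χ ≫ i) ≫ φ).hom := by
        rw [hr]
        exact e.2
      obtain ⟨x, hx⟩ := he
      exact ⟨q.hom x, Subtype.ext hx⟩
    exact ⟨IsNoetherian.injective_of_surjective_endomorphism _ hsurj, hsurj⟩
  have hiso : IsIso (i ≫ q) := (ConcreteCategory.isIso_iff_bijective _).2 (by
    have := hbij (𝟙 E) (Category.comp_id _)
    rwa [Category.id_comp] at this)
  let ρ : Retract E I := ⟨i, q ≫ inv (i ≫ q), by rw [← Category.assoc, IsIso.hom_inv_id]⟩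
  have hE : Injective E := ρ.injective
  have hg : Mono (f ≫ q) := by
    have : Mono ((f ≫ q) ≫ i) := by rwa [Category.assoc, hqi, hφ]
    exact mono_of_mono _ i
  refine ⟨E, f ≫ q, ⟨ρ⟩, hg, fun L hL hdis => hL ?_⟩
  let π : E ⟶ ModuleCat.of R (E ⧸ L) := ModuleCat.ofHom L.mkQ
  have hmono : Mono ((f ≫ q) ≫ π) := by
    rw [ModuleCat.mono_iff_injective, injective_iff_map_eq_zero]
    intro x hx
    have h1 : (f ≫ q).hom x ∈ L := (Submodule.Quotient.mk_eq_zero L).1 hx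
    have h2 : (f ≫ q).hom x ∈ LinearMap.range (f ≫ q).hom ⊓ L := ⟨⟨x, rfl⟩, h1⟩
    rw [hdis] at h2
    exact (injective_iff_map_eq_zero _).1 ((ModuleCat.mono_iff_injective _).1 hg) x h2
  -- If `L` misses the image of `M`, then `M` embeds in `E ⧸ L`, and the composite of `π` with the
  -- extension `t` fixes `M`. By `hbij`, `π` is then injective, so `L` is zero.
  let t := Injective.factorThru (f ≫ q) ((f ≫ q) ≫ π)
  have ht : ((f ≫ q) ≫ π) ≫ t = f ≫ q := Injective.comp_factorThru _ _
  have hinj := (hbij (π ≫ t) (by rw [← Category.assoc, ht])).1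
  refine eq_bot_iff.2 fun x hx => ?_
  have h0 : π.hom x = 0 := (Submodule.Quotient.mk_eq_zero L).2 hx
  refine (injective_iff_map_eq_zero _).1 hinj x ?_
  have h1 : ((π ≫ t) ≫ i ≫ q).hom x = (t ≫ i ≫ q).hom (π.hom x) := rfl
  rw [h1, h0, map_zero]

end Hull

/-! ### Dominant dimension through Ext vanishing -/

section DominantDimension

variable {R : Type u} [Ring R]

/-- Vanishing of `Ext^j` from torsion modules, for `j < m`. -/
def LeftTorsionExtZero (m : ℕ) (M : ModuleCat.{u} R) : Prop :=
  Module.Finite R M ∧ ∀ Z : ModuleCat.{u} R, IsLeftTorsion Z → ∀ j < m, ExtZero.{u} Z M j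

theorem LeftTorsionExtZero.exists_ses [IsArtinianRing R] (hR : EnoughFiniteInjectives R) {m : ℕ}
    {M : ModuleCat.{u} R} (h : LeftTorsionExtZero m M) :
    ∃ (E N : ModuleCat.{u} R) (f : M ⟶ E) (g : E ⟶ N), IsSES f g ∧ Injective E ∧
      IsEssentialSubmodule (LinearMap.range f.hom) ∧ (0 < m → Projective E) ∧
      LeftTorsionExtZero (m - 1) N := by
  obtain ⟨hM, hZM⟩ := h
  obtain ⟨I, f₀, hI, hIfin, hmono, hproj⟩ : ∃ (I : ModuleCat.{u} R) (f : M ⟶ I), Injective I ∧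
      Module.Finite R I ∧ Mono f ∧ (0 < m → IsProjInj I) := by
    rcases Nat.eq_zero_or_pos m with rfl | hm
    · obtain ⟨I, f, hf, hI, hIfin⟩ := hR M hM
      exact ⟨I, f, hI, hIfin, hf, fun h => absurd h (lt_irrefl 0)⟩
    · obtain ⟨Q, f, hQ, hf⟩ := exists_mono_of_separating ⟨_, isProjInj_punit⟩
        (fun Q hQ => hQ.injective) (fun P Q => isProjInj_biprod) hM
        fun Z hZ hZ' => hZM Z ⟨hZ, hZ'⟩ 0 hm
      exact ⟨Q, f, hQ.injective, hQ.finite, hf, fun _ => hQ⟩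
  obtain ⟨E, g, ⟨r⟩, hg, hess⟩ := exists_essential_retract f₀ hIfin
  have hs := IsSES.of_mono g
  refine ⟨E, _, g, _, hs, r.injective, hess, fun hm => ((hproj hm).retract r).projective,
    hs.finite_right (finite_of_retract r hIfin), fun Z hZ j hj => ?_⟩
  exact hs.extZero_right Z (hZ.extZero ((hproj (by omega)).retract r) j)
    (hZM Z hZ (j + 1) (by omega))

theorem LeftTorsionExtZero.le_dominantDimension [IsArtinianRing R] (hR : EnoughFiniteInjectives R)
    {m : ℕ} {M : ModuleCat.{u} R} (h : LeftTorsionExtZero m M) :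
    (m : ℕ∞) ≤ dominantDimension M := by
  choose E N f g hs hE hess hproj hN using
    fun (k : ℕ) (X : {X : ModuleCat.{u} R // LeftTorsionExtZero k X}) => X.2.exists_ses hR
  -- Truncated subtraction is intended: after `m` steps the condition is only finite generation, and
  -- the minimal resolution continues with no demand of projectivity.
  let s : ∀ n : ℕ, {X : ModuleCat.{u} R // LeftTorsionExtZero (m - n) X} := fun n =>
    Nat.rec ⟨M, h⟩ (fun n X => ⟨N (m - n) X, hN (m - n) X⟩) n
  have hses : ∀ n, IsSES (X := (s n).1) (Z := (s (n + 1)).1) (f (m - n) (s n)) (g (m - n) (s n)) :=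
    fun n => hs (m - n) (s n)
  refine le_sSup ⟨spliceResolution hses fun n => hE (m - n) (s n), fun n => ?_, fun j hj => ?_⟩
  · have := hess (m - n) (s n)
    rw [← splice_ker_d hses n] at this
    exact this
  · exact hproj (m - j) (s j) (by
      have : j < m := by exact_mod_cast hj
      omega)

section Minimal

variable {M : ModuleCat.{u} R} (I : InjectiveResolution M)

/-- The cocycle modules of an injective resolution. -/
abbrev cosyzygy (n : ℕ) : ModuleCat.{u} R :=
  ModuleCat.of R (LinearMap.ker (I.cocomplex.d n (n + 1)).hom)

/-- The inclusion of the cocycles. -/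
def cosyzygyι (n : ℕ) : cosyzygy I n ⟶ I.cocomplex.X n := ModuleCat.ofHom (Submodule.subtype _)

/-- The map onto the next cocycle module. -/
def cosyzygyπ (n : ℕ) : I.cocomplex.X n ⟶ cosyzygy I (n + 1) :=
  ModuleCat.ofHom ((I.cocomplex.d n (n + 1)).hom.codRestrict _ fun x =>
    congrArg (fun k : I.cocomplex.X n ⟶ I.cocomplex.X (n + 2) => k.hom x) (I.complex_d_comp n))

theorem isSES_cosyzygy (n : ℕ) : IsSES (cosyzygyι I n) (cosyzygyπ I n) := by
  refine IsSES.of_linearMap Subtype.val_injective ?_ ?_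
  · rintro ⟨x, hx⟩
    obtain ⟨y, hy⟩ := (ShortComplex.moduleCat_exact_iff _).1 (I.exact_succ n) x hx
    exact ⟨y, Subtype.ext hy⟩
  · refine (Submodule.range_subtype _).trans ?_
    ext x
    exact (Subtype.ext_iff (a1 := (cosyzygyπ I n).hom x) (a2 := 0)).symm

theorem nonempty_iso_cosyzygy_zero : Nonempty (M ≅ cosyzygy I 0) := by
  let f : M ⟶ I.cocomplex.X 0 := I.ι.f 0
  have hf : Function.Injective f.hom := (ModuleCat.mono_iff_injective f).1
    (inferInstanceAs (Mono (I.ι.f 0)))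
  have hr : LinearMap.range f.hom = LinearMap.ker (I.cocomplex.d 0 1).hom :=
    (ShortComplex.moduleCat_exact_iff_range_eq_ker _).1 I.exact₀
  exact ⟨((LinearEquiv.ofInjective f.hom hf).trans (LinearEquiv.ofEq _ _ hr)).toModuleIso⟩

/-- An embedding of `M` in a finitely generated injective extends to `E` and stays injective by
essentiality. Hence the terms of a minimal injective resolution are finitely generated, as
`IsProjInj` demands. -/
theorem finite_of_essential [IsNoetherianRing R] (hR : EnoughFiniteInjectives R)
    {M E : ModuleCat.{u} R} (f : M ⟶ E) [Mono f] (hM : Module.Finite R M)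
    (hess : IsEssentialSubmodule (LinearMap.range f.hom)) : Module.Finite R E := by
  obtain ⟨J, k, hk, hJ, hJfin⟩ := hR M hM
  let l := Injective.factorThru k f
  have hl : f ≫ l = k := Injective.comp_factorThru k f
  have : Mono l := by
    rw [ModuleCat.mono_iff_ker_eq_bot]
    by_contra hne
    refine hess _ hne (eq_bot_iff.2 ?_)
    rintro _ ⟨⟨x, rfl⟩, hx⟩
    have h1 : k.hom x = 0 := by rw [← hl]; exact hx
    rw [(injective_iff_map_eq_zero _).1 ((ModuleCat.mono_iff_injective k).1 hk) x h1, map_zero]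
    exact Submodule.zero_mem _
  exact finite_of_mono l hJfin

variable {I}

theorem IsMinimalInjectiveResolution.finite [IsNoetherianRing R] (hR : EnoughFiniteInjectives R)
    (hI : IsMinimalInjectiveResolution I) (hM : Module.Finite R M) (n : ℕ) :
    Module.Finite R (cosyzygy I n) ∧ Module.Finite R (I.cocomplex.X n) := by
  have key : ∀ n, Module.Finite R (cosyzygy I n) → Module.Finite R (I.cocomplex.X n) := by
    intro n hn
    have := (isSES_cosyzygy I n).mono
    refine finite_of_essential hR (cosyzygyι I n) hn ?_
    have h1 : LinearMap.range (cosyzygyι I n).hom = _ := Submodule.range_subtype _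
    rw [h1]
    exact hI n
  induction n with
  | zero =>
    obtain ⟨e⟩ := nonempty_iso_cosyzygy_zero I
    have := finite_of_iso e hM
    exact ⟨this, key 0 this⟩
  | succ n ih =>
    have := (isSES_cosyzygy I n).finite_right ih.2
    exact ⟨this, key _ this⟩

theorem IsMinimalInjectiveResolution.hasProjInjCopresentation [IsNoetherianRing R]
    (hR : EnoughFiniteInjectives R) (hI : IsMinimalInjectiveResolution I)
    (hM : Module.Finite R M) {m : ℕ} {n : ℕ}
    (hproj : ∀ j < m, Projective (I.cocomplex.X (n + j))) :
    HasProjInjCopresentation m (cosyzygy I n) := by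
  induction m generalizing n with
  | zero => trivial
  | succ m ih =>
    refine ⟨_, _, _, _, isSES_cosyzygy I n,
      ⟨hproj 0 (by omega), I.injective n, (hI.finite hR hM n).2⟩, ih fun j hj => ?_⟩
    have := hproj (j + 1) (by omega)
    rwa [show n + (j + 1) = n + 1 + j by omega] at this

end Minimal

theorem hasProjInjCopresentation_of_le_dominantDimension [IsNoetherianRing R]
    (hR : EnoughFiniteInjectives R) {M : ModuleCat.{u} R} (hM : Module.Finite R M) {m : ℕ}
    (h : (m : ℕ∞) ≤ dominantDimension M) : HasProjInjCopresentation m M := by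
  cases m with
  | zero => trivial
  | succ m =>
    -- The supremum need not be attained, so a member of the set strictly above `m` is used; it
    -- covers the terms with index at most `m`.
    have h1 : (m : ℕ∞) < dominantDimension M :=
      lt_of_lt_of_le (by exact_mod_cast Nat.lt_succ_self m) h
    obtain ⟨n, ⟨I, hI, hproj⟩, hn⟩ := lt_sSup_iff.1 h1
    obtain ⟨e⟩ := nonempty_iso_cosyzygy_zero I
    refine (hI.hasProjInjCopresentation hR hM fun j hj => ?_).of_iso e
    rw [Nat.zero_add]
    exact hproj j (lt_of_le_of_lt (by exact_mod_cast Nat.lt_succ_iff.1 hj) hn)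

end DominantDimension

/-! ### Duality for projective-injective (co)presentations -/

section Codominant

open OppositePair

variable {K R S : Type u} [Field K] [Ring R] [Ring S] [Algebra K R] [Algebra K S]
  [Module.Finite K R] [Module.Finite K S] (p : OppositePair K R S)

theorem IsProjInj.dual {Q : ModuleCat.{u} R} (hQ : IsProjInj Q) : IsProjInj (p.dual Q) :=
  have := hQ.projective
  ⟨p.projective_dual Q hQ.injective hQ.finite, injective_dual Q, p.finite_dual Q hQ.finite⟩

theorem HasProjInjPresentation.dual {m : ℕ} {M : ModuleCat.{u} R}
    (h : HasProjInjPresentation m M) : HasProjInjCopresentation m (p.dual M) := by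
  induction m generalizing M with
  | zero => trivial
  | succ m ih =>
    obtain ⟨N, Q, f, g, hs, hQ, hN⟩ := h
    exact ⟨_, _, _, _, hs.dual p, hQ.dual p, ih hN⟩

theorem HasProjInjCopresentation.dual {m : ℕ} {M : ModuleCat.{u} R}
    (h : HasProjInjCopresentation m M) : HasProjInjPresentation m (p.dual M) := by
  induction m generalizing M with
  | zero => trivial
  | succ m ih =>
    obtain ⟨Q, N, f, g, hs, hQ, hN⟩ := h
    exact ⟨_, _, _, _, hs.dual p, hQ.dual p, ih hN⟩

theorem hasProjInjCopresentation_dual_iff {m : ℕ} {M : ModuleCat.{u} R} (hM : Module.Finite R M) :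
    HasProjInjCopresentation m (p.dual M) ↔ HasProjInjPresentation m M := by
  refine ⟨fun h => ?_, fun h => h.dual p⟩
  have := p.isIso_eval M hM
  exact (h.dual p.symm).of_iso (asIso (p.eval M)).symm

end Codominant

/-! ### Injective cogenerators and injective coresolutions -/

section Cogenerator

variable {R : Type u} [Ring R] {J : ModuleCat.{u} R}

theorem addClosure.injective {I : ModuleCat.{u} R} (h : addClosure J I) (hJ : Injective J) :
    Injective I := by
  rw [injective_iff_subsingleton_ext_one]
  exact fun {Y} => h.extZero_right (.of_injective Y J 0)

theorem IsCogenerator.exists_mono_power (K : Type u) [Field K] [Algebra K R] [Module.Finite K R]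
    (hJc : IsCogenerator J) (hJfin : Module.Finite R J) (M : ModuleCat.{u} R)
    (hM : Module.Finite R M) : ∃ (n : ℕ) (f : M ⟶ power J n), Mono f := by
  obtain ⟨n, f, hf⟩ := exists_left_approximation K M J hM hJfin
  refine ⟨n, f, (ModuleCat.mono_iff_injective f).2 ((injective_iff_map_eq_zero _).2 fun x hx => ?_)⟩
  refine hJc M hM x fun φ => ?_
  obtain ⟨l, rfl⟩ := hf φ
  exact (congrArg l.hom hx).trans (map_zero _)

theorem IsCogenerator.enoughFiniteInjectives (K : Type u) [Field K] [Algebra K R]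
    [Module.Finite K R] (hJc : IsCogenerator J) (hJ : Injective J) (hJfin : Module.Finite R J) :
    EnoughFiniteInjectives R := fun M hM => by
  obtain ⟨n, f, hf⟩ := hJc.exists_mono_power K hJfin M hM
  exact ⟨_, f, hf, (addClosure_power J n).injective hJ, finite_power hJfin n⟩

theorem IsCogenerator.addClosure_of_injective (K : Type u) [Field K] [Algebra K R]
    [Module.Finite K R] (hJc : IsCogenerator J) (hJfin : Module.Finite R J) {I : ModuleCat.{u} R}
    (hI : Injective I) (hIfin : Module.Finite R I) : addClosure J I := by
  obtain ⟨n, f, hf⟩ := hJc.exists_mono_power K hJfin I hIfin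
  exact ⟨n, ⟨⟨f, Injective.factorThru (𝟙 I) f, Injective.comp_factorThru _ _⟩⟩⟩

theorem HasCoresolution.mono {C D : ObjectProperty (ModuleCat.{u} R)} (h : ∀ X, C X → D X) :
    ∀ {n : ℕ} {M : ModuleCat.{u} R}, HasCoresolution C n M → HasCoresolution D n M
  | 0, _, ⟨X, hX, e⟩ => ⟨X, h X hX, e⟩
  | _ + 1, _, ⟨X, N, f, g, w, hS, hX, hN⟩ => ⟨X, N, f, g, w, hS, h X hX, hN.mono h⟩

/-- The finitely generated injective modules. -/
def finiteInjective : ObjectProperty (ModuleCat.{u} R) := fun I =>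
  Injective I ∧ Module.Finite R I

theorem hasCoresolution_of_injectiveDimension (hR : EnoughFiniteInjectives R) {n : ℕ}
    {M : ModuleCat.{u} R} (hM : Module.Finite R M)
    (h : injectiveDimension M ≤ (n : WithBot ℕ∞)) : HasCoresolution finiteInjective n M := by
  rw [injectiveDimension_le_iff_extZero] at h
  induction n generalizing M with
  | zero =>
    refine ⟨M, ⟨injective_iff_subsingleton_ext_one.2 fun {Y} => h Y 0, hM⟩, ⟨Iso.refl M⟩⟩
  | succ n ih =>
    obtain ⟨I, N, f, g, hs, hI, hIfin, hN⟩ := hR.exists_ses M hM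
    refine ⟨I, N, f, g, hs.choose, hs.choose_spec, ⟨hI, hIfin⟩, ih hN fun Y k => ?_⟩
    rw [show n + 1 + k = n + k + 1 by omega]
    refine hs.extZero_right Y (.of_injective Y I _) ?_
    convert h Y k using 1
    omega

/-- Applied to the left regular module, this turns its finite injective dimension into a finite
projective resolution of `D(A)`. -/
theorem HasCoresolution.dual {K S : Type u} [Field K] [Ring S] [Algebra K R] [Algebra K S]
    [Module.Finite K R] [Module.Finite K S] (p : OppositePair K R S) :
    ∀ {n : ℕ} {M : ModuleCat.{u} R}, HasCoresolution finiteInjective n M →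
      HasResolution (addClosure (regular S)) n (p.dual M)
  | 0, M, ⟨X, hX, ⟨e⟩⟩ => ⟨p.dual X,
      addClosure_regular_iff.2 ⟨p.projective_dual X hX.1 hX.2, p.finite_dual X hX.2⟩,
      ⟨⟨p.dualMap e.hom, p.dualMap e.inv,
        (OppositePair.dualMap_comp e.inv e.hom).symm.trans
          ((congrArg p.dualMap e.inv_hom_id).trans (OppositePair.dualMap_id X)),
        (OppositePair.dualMap_comp e.hom e.inv).symm.trans
          ((congrArg p.dualMap e.hom_inv_id).trans (OppositePair.dualMap_id M))⟩⟩⟩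
  | _ + 1, _, ⟨X, N, f, g, w, hS, hX, hN⟩ =>
    have hs : IsSES f g := ⟨w, hS⟩
    ⟨p.dual N, p.dual X, p.dualMap g, p.dualMap f, (hs.dual p).choose, (hs.dual p).choose_spec,
      addClosure_regular_iff.2 ⟨p.projective_dual X hX.1 hX.2, p.finite_dual X hX.2⟩,
      hN.dual p⟩

end Cogenerator

/-! ### Codominant dimension of the injective cogenerator -/

section Symmetry

variable {R : Type u} [Ring R] {J : ModuleCat.{u} R}

/-- The finitely generated injectives without `Ext^j` to right torsion modules, for `j < r`. -/
def CodominantInjective (r : ℕ) : ObjectProperty (ModuleCat.{u} R) := fun E =>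
  Injective E ∧ Module.Finite R E ∧
    ∀ Z : ModuleCat.{u} R, IsRightTorsion Z → ∀ j < r, ExtZero.{u} E Z j

theorem ExtZero.biprod_left {C : Type*} [Category C] [Abelian C] [HasExt.{u} C] {P Q Z : C} {n : ℕ}
    (hP : ExtZero.{u} P Z n) (hQ : ExtZero.{u} Q Z n) : ExtZero (P ⊞ Q) Z n := by
  have h : IsSES (biprod.inl : P ⟶ P ⊞ Q) biprod.snd :=
    ⟨biprod.inl_snd, (ShortComplex.Splitting.ofHasBinaryBiproduct P Q).shortExact⟩
  exact h.zeroExt_mid Z hP hQ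

theorem codominantInjective_biprod {r : ℕ} {P Q : ModuleCat.{u} R} (hP : CodominantInjective r P)
    (hQ : CodominantInjective r Q) : CodominantInjective r (P ⊞ Q) :=
  have := hP.1
  have := hQ.1
  ⟨inferInstance, finite_biprod hP.2.1 hQ.2.1,
    fun Z hZ j hj => (hP.2.2 Z hZ j hj).biprod_left (hQ.2.2 Z hZ j hj)⟩

theorem IsProjInj.codominantInjective {Q : ModuleCat.{u} R} (hQ : IsProjInj Q) (r : ℕ) :
    CodominantInjective r Q :=
  ⟨hQ.injective, hQ.finite, fun _ hZ j _ => hZ.extZero hQ j⟩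

/-- Each cosyzygy gains one degree of Ext vanishing into right torsion modules, since
projective-injectives have none. After `m` steps the cosyzygy is injective by `hid`, with vanishing
below `k + m`. -/
theorem HasProjInjCopresentation.hasCoresolution {m k : ℕ} {M : ModuleCat.{u} R}
    (h : HasProjInjCopresentation m M) (hM : Module.Finite R M)
    (hid : ∀ (Y : ModuleCat.{u} R) n, ExtZero.{u} Y M (m + 1 + n))
    (hZ : ∀ Z : ModuleCat.{u} R, IsRightTorsion Z → ∀ j < k, ExtZero.{u} M Z j) :
    HasCoresolution (CodominantInjective (k + m)) m M := by
  induction m generalizing k M with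
  | zero =>
    exact ⟨M, ⟨injective_iff_subsingleton_ext_one.2 fun {Y} => hid Y 0, hM, hZ⟩, ⟨Iso.refl M⟩⟩
  | succ m ih =>
    obtain ⟨Q, N, f, g, hs, hQ, hN⟩ := h
    have := hQ.injective
    have hN' := ih (k := k + 1) hN (hs.finite_right hQ.finite) (fun Y n => by
      rw [show m + 1 + n = m + n + 1 by omega]
      refine hs.extZero_right Y (.of_injective Y Q _) ?_
      convert hid Y n using 1
      omega) fun Z hZZ j hj => by
        cases j with
        | zero => exact hs.zeroExt_right_zero Z (hZZ.extZero hQ 0)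
        | succ j => exact hs.zeroExt_right Z (hZ Z hZZ j (by omega)) (hZZ.extZero hQ _)
    rw [show k + 1 + m = k + (m + 1) by omega] at hN'
    exact ⟨Q, N, f, g, hs.choose, hs.choose_spec, hQ.codominantInjective _, hN'⟩

theorem HasCoresolution.extZero_of_injective {D : ObjectProperty (ModuleCat.{u} R)}
    (hD : ∀ E, D E → Injective E) {Z : ModuleCat.{u} R} (hZ : ∀ E, D E → ExtZero.{u} Z E 0) :
    ∀ {m : ℕ} {M : ModuleCat.{u} R}, HasCoresolution D m M → ∀ k, ExtZero.{u} Z M k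
  | 0, _, ⟨E, hE, ⟨e⟩⟩, k => by
    have hZE : ExtZero.{u} Z E k := by
      cases k with
      | zero => exact hZ E hE
      | succ k => exact have := hD E hE; .of_injective Z E k
    exact hZE.retract_right (.ofIso e)
  | m + 1, _, ⟨E, N, f, g, w, hS, hE, hN⟩, k => by
    have hs : IsSES f g := ⟨w, hS⟩
    cases k with
    | zero => exact hs.extZero_left_zero Z (hZ E hE)
    | succ k =>
      have := hD E hE
      exact hs.extZero_left Z (hN.extZero_of_injective hD hZ k) (.of_injective Z E k)

theorem HasResolution.extZero_of_extZero {U Z : ModuleCat.{u} R} (hZ : ∀ k, ExtZero.{u} Z U k) :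
    ∀ {m : ℕ} {N : ModuleCat.{u} R}, HasResolution (addClosure U) m N → ∀ k, ExtZero.{u} Z N k
  | 0, _, ⟨_, hC, ⟨e⟩⟩, n => (hC.extZero_right (hZ n)).retract_right (.ofIso e.symm)
  | _ + 1, _, ⟨_, _, _, _, w, hS, hC, hN⟩, n =>
    IsSES.extZero_right Z ⟨w, hS⟩ (hC.extZero_right (hZ n)) (hN.extZero_of_extZero hZ (n + 1))

/-- For an algebra whose injective dimension is bounded by its dominant dimension, the injective
cogenerator has the corresponding codominant dimension. -/
theorem extZero_cogenerator_of_isRightTorsion [IsArtinianRing R] (hJ : Injective J)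
    (hJfin : Module.Finite R J) {r n : ℕ}
    (hdom : HasProjInjCopresentation r (regular R))
    (hid : injectiveDimension (regular R) ≤ (r : WithBot ℕ∞))
    (hres : HasResolution (addClosure (regular R)) n J)
    {Z : ModuleCat.{u} R} (hZ : IsRightTorsion Z) {j : ℕ} (hj : j < r) : ExtZero.{u} J Z j := by
  have hco := hdom.hasCoresolution (k := 0) finite_regular
    (injectiveDimension_le_iff_extZero.1 hid) (fun Z _ j hj => absurd hj (Nat.not_lt_zero j))
  rw [Nat.zero_add] at hco
  -- A module with no maps to the class has no Ext to `A` in any degree, via the coresolution of `A`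
  -- inside the class. Hence it has none to `J`, via the projective resolution of `J`. So `J` embeds
  -- in a member of the class, and splits off.
  obtain ⟨E, f, hE, hf⟩ := exists_mono_of_separating (D := CodominantInjective r)
    ⟨_, isProjInj_punit.codominantInjective r⟩ (fun Q hQ => hQ.1)
    (fun P Q => codominantInjective_biprod) hJfin fun Z _ hZ =>
      hres.extZero_of_extZero (hco.extZero_of_injective (fun E hE => hE.1) hZ) 0
  exact (hE.2.2 Z hZ j hj).retract_left
    ⟨f, Injective.factorThru (𝟙 J) f, Injective.comp_factorThru _ _⟩

end Symmetry

/-! ### Doubly infinite acyclic complexes -/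

section Acyclic

variable {R : Type u} [Ring R]

theorem exists_int_sequence {Pr D : ObjectProperty (ModuleCat.{u} R)}
    (hnext : ∀ X, Pr X → ∃ (E X' : ModuleCat.{u} R) (f : X ⟶ E) (g : E ⟶ X'), IsSES f g ∧ D E ∧ Pr X')
    (hprev : ∀ X, Pr X → ∃ (X' E : ModuleCat.{u} R) (f : X' ⟶ E) (g : E ⟶ X), IsSES f g ∧ D E ∧ Pr X')
    (X : ModuleCat.{u} R) (hX : Pr X) :
    ∃ (M E : ℤ → ModuleCat.{u} R) (f : ∀ n, M n ⟶ E n) (g : ∀ n, E n ⟶ M (n + 1)),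
      (∀ n, IsSES (f n) (g n)) ∧ (∀ n, D (E n)) ∧ (∀ n, Pr (M n)) ∧ M 0 = X := by
  let C := {X : ModuleCat.{u} R // Pr X}
  choose E₁ X₁ f₁ g₁ hs₁ hE₁ hX₁ using fun X : C => hnext X.1 X.2
  choose X₂ E₂ f₂ g₂ hs₂ hE₂ hX₂ using fun X : C => hprev X.1 X.2
  let next : C → C := fun X => ⟨X₁ X, hX₁ X⟩
  let prev : C → C := fun X => ⟨X₂ X, hX₂ X⟩
  let a : ℕ → C := fun n => Nat.rec ⟨X, hX⟩ (fun _ Y => next Y) n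
  let b : ℕ → C := fun n => Nat.rec ⟨X, hX⟩ (fun _ Y => prev Y) n
  let M : ℤ → C := fun n => match n with
    | .ofNat n => a n
    | .negSucc n => b (n + 1)
  have h : ∀ n : ℤ, ∃ (E : ModuleCat.{u} R) (f : (M n).1 ⟶ E) (g : E ⟶ (M (n + 1)).1),
      IsSES f g ∧ D E := by
    intro n
    match n with
    | .ofNat n => exact ⟨E₁ (a n), f₁ (a n), g₁ (a n), hs₁ (a n), hE₁ (a n)⟩
    -- The two half-sequences meet here: `a 0` and `b 0` are both the starting module.
    | .negSucc 0 => exact ⟨E₂ (b 0), f₂ (b 0), g₂ (b 0), hs₂ (b 0), hE₂ (b 0)⟩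
    | .negSucc (n + 1) =>
      exact ⟨E₂ (b (n + 1)), f₂ (b (n + 1)), g₂ (b (n + 1)), hs₂ (b (n + 1)), hE₂ (b (n + 1))⟩
  choose E f g hs hE using h
  exact ⟨fun n => (M n).1, E, f, g, hs, hE, fun n => (M n).2, rfl⟩

variable {M E : ℤ → ModuleCat.{u} R} {f : ∀ n, M n ⟶ E n} {g : ∀ n, E n ⟶ M (n + 1)}

theorem splice_acyclic (h : ∀ n, IsSES (f n) (g n)) : (splice h).Acyclic := by
  intro n
  obtain ⟨m, rfl⟩ : ∃ m, n = m + 1 := ⟨n - 1, by omega⟩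
  rw [HomologicalComplex.exactAt_iff' _ m (m + 1) (m + 1 + 1) (by simp) (by simp)]
  exact splice_exact h m

theorem iCycles_injective (P : CochainComplex (ModuleCat.{u} R) ℤ) (n : ℤ) :
    Function.Injective (P.iCycles n).hom :=
  (ModuleCat.mono_iff_injective (P.iCycles n)).1 inferInstance

theorem range_iCycles (P : CochainComplex (ModuleCat.{u} R) ℤ) (n : ℤ) :
    LinearMap.range (P.iCycles n).hom = LinearMap.ker (P.d n (n + 1)).hom :=
  (ShortComplex.moduleCat_exact_iff_range_eq_ker _).1
    (ShortComplex.exact_of_f_is_kernel (ShortComplex.mk _ _ (P.iCycles_d n (n + 1)))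
      (P.cyclesIsKernel n (n + 1) (by simp)))

theorem nonempty_iso_cycles (h : ∀ n, IsSES (f n) (g n)) (n : ℤ) :
    Nonempty (M n ≅ (splice h).cycles n) := by
  let f' : M n ⟶ (splice h).X n := f n
  let l := (splice h).liftCycles f' (n + 1) (by simp) (splice_f_d h n)
  have hl : ∀ x, ((splice h).iCycles n).hom (l.hom x) = f'.hom x := fun x =>
    congrArg (fun k : M n ⟶ (splice h).X n => k.hom x) ((splice h).liftCycles_i _ _ _ _)
  have hbij : Function.Bijective l.hom := by
    refine ⟨fun x y hxy => (h n).injective ?_, fun z => ?_⟩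
    · exact (hl x).symm.trans ((congrArg _ hxy).trans (hl y))
    · have hz : ((splice h).iCycles n).hom z ∈ LinearMap.ker ((splice h).d n (n + 1)).hom :=
        range_iCycles (splice h) n ▸ ⟨z, rfl⟩
      rw [splice_ker_d h n] at hz
      obtain ⟨x, hx⟩ := hz
      exact ⟨x, iCycles_injective _ n ((hl x).trans hx)⟩
  have : IsIso l := (ConcreteCategory.isIso_iff_bijective l).2 hbij
  exact ⟨asIso l⟩

theorem isSES_cycles {P : CochainComplex (ModuleCat.{u} R) ℤ} (hP : P.Acyclic) (n : ℤ) :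
    IsSES (P.iCycles n) (P.toCycles n (n + 1)) := by
  have hd : ∀ x, (P.iCycles (n + 1)).hom ((P.toCycles n (n + 1)).hom x) = (P.d n (n + 1)).hom x :=
    fun x => congrArg (fun k : P.X n ⟶ P.X (n + 1) => k.hom x) (P.toCycles_i n (n + 1))
  have hinj := iCycles_injective P (n + 1)
  refine IsSES.of_linearMap (iCycles_injective P n) (fun z => ?_) ?_
  · have hex := (HomologicalComplex.exactAt_iff' P n (n + 1) (n + 1 + 1) (by simp) (by simp)).1
      (hP (n + 1))
    have hz : (P.iCycles (n + 1)).hom z ∈ LinearMap.ker (P.d (n + 1) (n + 1 + 1)).hom :=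
      range_iCycles P (n + 1) ▸ ⟨z, rfl⟩
    obtain ⟨x, hx⟩ := (ShortComplex.moduleCat_exact_iff _).1 hex _ hz
    exact ⟨x, hinj ((hd x).trans hx)⟩
  · rw [range_iCycles]
    ext x
    rw [LinearMap.mem_ker, LinearMap.mem_ker, ← hd]
    exact (injective_iff_map_eq_zero' _).1 hinj _

end Acyclic

/-! ### Gorenstein projective and injective modules -/

section Gorenstein

variable {R : Type u} [Ring R]

/-- Continue `X` to the left by free covers and to the right by embeddings in free modules, which
exist because the regular module is cotilting. All cocycles stay in `⊥A`, so `Hom(-, Q)` keeps the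
complex exact. -/
theorem gorensteinProjective_of_leftPerp [IsNoetherianRing R] (K : Type u) [Field K] [Algebra K R]
    [Module.Finite K R] {J : ModuleCat.{u} R} (hA : IsCotiltingFor J (regular R))
    {X : ModuleCat.{u} R} (hX : leftPerp (addClosure (regular R)) X) : gorensteinProjective X := by
  obtain ⟨M, E, f, g, hs, hE, hM, rfl⟩ := exists_int_sequence
    (Pr := leftPerp (addClosure (regular R))) (D := addClosure (regular R))
    (fun X hX => by
      obtain ⟨n, X', f, g, hs, hX'⟩ := hA.exists_ses_of_leftPerp K hX
      exact ⟨_, X', f, g, hs, addClosure_power _ n, hX'⟩)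
    (fun X hX => by
      obtain ⟨N, P, f, g, hs, hN, hP, hPfin⟩ := exists_ses_projective X hX.1
      exact ⟨N, P, f, g, hs, addClosure_regular_iff.2 ⟨hP, hPfin⟩, leftPerp_of_extZero hN
        fun Y hY n => hs.zeroExt_left Y (.of_projective P Y n) (hX.extZero hY (n + 1))⟩) X hX
  refine ⟨splice hs, fun n => addClosure_regular_iff.1 (hE n), splice_acyclic hs, ?_,
    nonempty_iso_cycles hs 0⟩
  intro Q hQ hQfin n φ hφ
  -- Freeing the index `n - 1` permits the substitution `n = m + 1` without transporting along an
  -- equality of indices.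
  have hφ' : ∀ k, k = n - 1 → (splice hs).d k n ≫ φ = 0 := by
    rintro _ rfl
    exact hφ
  obtain ⟨m, rfl⟩ : ∃ m, n = m + 1 := ⟨n - 1, by omega⟩
  replace hφ' : (g m ≫ f (m + 1)) ≫ (show E (m + 1) ⟶ Q from φ) = 0 :=
    (congrArg (· ≫ φ) (splice_d hs m)).symm.trans (hφ' m (by omega))
  have := (hs m).epi
  rw [Category.assoc, ← comp_zero (f := g m), cancel_epi] at hφ'
  obtain ⟨l, hl⟩ := (hs (m + 1)).desc _ hφ'
  obtain ⟨t, ht⟩ := (hs (m + 1 + 1)).exists_desc Q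
    ((hM (m + 1 + 1 + 1)).extZero (addClosure_regular_iff.2 ⟨hQ, hQfin⟩) 0) l
  refine ⟨t, ?_⟩
  refine (congrArg (· ≫ t) (splice_d hs (m + 1))).trans ?_
  exact (Category.assoc _ _ _).trans ((congrArg (g (m + 1) ≫ ·) ht).trans hl)

theorem gorensteinInjective_of_rightPerp [IsNoetherianRing R] (K : Type u) [Field K] [Algebra K R]
    [Module.Finite K R] {J : ModuleCat.{u} R} (hJc : IsCogenerator J) (hJ : Injective J)
    (hJfin : Module.Finite R J) {m : ℕ} (hco : HasCoresolution (addClosure J) m (regular R))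
    {X : ModuleCat.{u} R} (hX : rightPerp (addClosure J) X) : gorensteinInjective X := by
  obtain ⟨M, E, f, g, hs, hE, hM, rfl⟩ := exists_int_sequence
    (Pr := rightPerp (addClosure J)) (D := addClosure J)
    (fun X hX => by
      obtain ⟨I, N, f, g, hs, hI, hIfin, hN⟩ :=
        (hJc.enoughFiniteInjectives K hJ hJfin).exists_ses X hX.1
      exact ⟨I, N, f, g, hs, hJc.addClosure_of_injective K hJfin hI hIfin, rightPerp_of_extZero hN
        fun Y hY n => hs.extZero_right Y (.of_injective Y I n) (hX.extZero hY (n + 1))⟩)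
    (fun X hX => by
      obtain ⟨hfin, hX⟩ := rightPerp_addClosure_iff.1 hX
      obtain ⟨n, X', f, g, hs, hfin', hX', -⟩ := exists_ses_power_of_generating K hJfin
        (fun n => .of_injective J J n) hfin hX (generating_of_hasCoresolution hco hX)
      exact ⟨X', _, f, g, hs, addClosure_power _ n, rightPerp_addClosure_iff.2 ⟨hfin', hX'⟩⟩) X hX
  refine ⟨splice hs, fun n => ⟨(hE n).injective hJ, (hE n).finite hJfin⟩, splice_acyclic hs, ?_,
    nonempty_iso_cycles hs 0⟩
  intro Q hQ hQfin n φ hφ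
  suffices h : ∀ k, k = n - 1 → ∃ t : Q ⟶ (splice hs).X k, t ≫ (splice hs).d k n = φ from h _ rfl
  intro k hk
  obtain rfl : n = k + 1 := by omega
  replace hφ : ((show Q ⟶ E (k + 1) from φ) ≫ g (k + 1)) ≫ f (k + 1 + 1) = 0 :=
    (Category.assoc _ _ _).trans ((congrArg (φ ≫ ·) (splice_d hs (k + 1))).symm.trans hφ)
  have := (hs (k + 1 + 1)).mono
  rw [← zero_comp (f := f (k + 1 + 1)), cancel_mono] at hφ
  obtain ⟨l, hl⟩ := (hs (k + 1)).lift _ hφ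
  obtain ⟨t, ht⟩ := (hs k).exists_lift Q
    ((hM k).extZero (hJc.addClosure_of_injective K hJfin hQ hQfin) 0) l
  refine ⟨t, ?_⟩
  refine (congrArg (t ≫ ·) (splice_d hs k)).trans ?_
  exact (Category.assoc _ _ _).symm.trans ((congrArg (· ≫ f (k + 1)) ht).trans hl)

/-- Moving one step to the right along the acyclic complex lowers the Ext degree by one, down to
Hom; the induction therefore treats all cocycle modules at once. -/
theorem gorensteinProjective.extZero {r : ℕ} {Z : ModuleCat.{u} R}
    (hZ : ∀ j < r, ExtZero.{u} Z (regular R) j) {X : ModuleCat.{u} R} (hX : gorensteinProjective X)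
    {j : ℕ} (hj : j < r) : ExtZero.{u} Z X j := by
  obtain ⟨P, hP, hac, -, ⟨e⟩⟩ := hX
  have key : ∀ (j : ℕ), j < r → ∀ n, ExtZero.{u} Z (P.cycles n) j := by
    intro j
    induction j with
    | zero =>
      intro hj n
      exact (isSES_cycles hac n).extZero_left_zero Z
        ((addClosure_regular_iff.2 (hP n)).extZero_right (hZ 0 hj))
    | succ j ih =>
      intro hj n
      exact (isSES_cycles hac n).extZero_left Z (ih (by omega) (n + 1))
        ((addClosure_regular_iff.2 (hP n)).extZero_right (hZ (j + 1) hj))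
  exact (key j hj 0).retract_right (.ofIso e)

theorem gorensteinInjective.extZero {r : ℕ} {J Z : ModuleCat.{u} R}
    (hJ : ∀ I : ModuleCat.{u} R, Injective I → Module.Finite R I → addClosure J I)
    (hZ : ∀ j < r, ExtZero.{u} J Z j) {X : ModuleCat.{u} R} (hX : gorensteinInjective X)
    {j : ℕ} (hj : j < r) : ExtZero.{u} X Z j := by
  obtain ⟨I, hI, hac, -, ⟨e⟩⟩ := hX
  have key : ∀ (j : ℕ), j < r → ∀ n, ExtZero.{u} (I.cycles (n + 1)) Z j := by
    intro j
    induction j with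
    | zero =>
      intro hj n
      exact (isSES_cycles hac n).zeroExt_right_zero Z
        ((hJ _ (hI n).1 (hI n).2).extZero_left (hZ 0 hj))
    | succ j ih =>
      intro hj n
      have := ih (by omega) (n - 1)
      rw [sub_add_cancel] at this
      exact (isSES_cycles hac n).zeroExt_right Z this
        ((hJ _ (hI n).1 (hI n).2).extZero_left (hZ (j + 1) hj))
  have h0 := key j hj (-1)
  rw [neg_add_cancel] at h0
  exact h0.retract_left (.ofIso e)

theorem HasResolution.extZero_of_gorensteinProjective {r : ℕ} {Z : ModuleCat.{u} R}
    (hZ : ∀ j < r, ExtZero.{u} Z (regular R) j) :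
    ∀ {k : ℕ} {X : ModuleCat.{u} R}, HasResolution gorensteinProjective k X →
      ∀ j, j + k < r → ExtZero.{u} Z X j
  | 0, _, ⟨_, hG, ⟨e⟩⟩, _, hj => (hG.extZero hZ hj).retract_right (.ofIso e.symm)
  | k + 1, _, ⟨_, _, _, _, w, hS, hG, hN⟩, j, hj =>
    IsSES.extZero_right Z ⟨w, hS⟩ (hG.extZero hZ (by omega))
      (hN.extZero_of_gorensteinProjective hZ (j + 1) (by omega))

theorem HasCoresolution.extZero_of_gorensteinInjective {r : ℕ} {J Z : ModuleCat.{u} R}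
    (hJ : ∀ I : ModuleCat.{u} R, Injective I → Module.Finite R I → addClosure J I)
    (hZ : ∀ j < r, ExtZero.{u} J Z j) :
    ∀ {k : ℕ} {X : ModuleCat.{u} R}, HasCoresolution gorensteinInjective k X →
      ∀ j, j + k < r → ExtZero.{u} X Z j
  | 0, _, ⟨_, hG, ⟨e⟩⟩, _, hj => (hG.extZero hJ hZ hj).retract_left (.ofIso e)
  | k + 1, _, ⟨_, _, _, _, w, hS, hG, hN⟩, j, hj =>
    IsSES.zeroExt_left Z ⟨w, hS⟩ (hG.extZero hJ hZ (by omega))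
      (hN.extZero_of_gorensteinInjective hJ hZ (j + 1) (by omega))

/-- The `i`-th syzygy lies in `⊥A`; the earlier terms are projective, hence also in `⊥A`. -/
theorem hasResolution_gorensteinProjective [IsNoetherianRing R] {i : ℕ}
    (hG : ∀ X : ModuleCat.{u} R, leftPerp (addClosure (regular R)) X → gorensteinProjective X)
    {X : ModuleCat.{u} R} (hX : Module.Finite R X)
    (h : ∀ n, ExtZero.{u} X (regular R) (i + 1 + n)) : HasResolution gorensteinProjective i X := by
  induction i generalizing X with
  | zero =>
    refine ⟨X, hG X (leftPerp_addClosure_iff.2 ⟨hX, fun n => ?_⟩), ⟨Iso.refl X⟩⟩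
    convert h n using 1
    omega
  | succ i ih =>
    obtain ⟨N, P, f, g, hs, hN, hP, hPfin⟩ := exists_ses_projective X hX
    refine ⟨N, P, f, g, hs.choose, hs.choose_spec, hG P (leftPerp_of_projective hP hPfin _),
      ih hN fun n => ?_⟩
    rw [show i + 1 + n = i + n + 1 by omega]
    refine hs.zeroExt_left _ (.of_projective P _ _) ?_
    convert h n using 1
    omega

theorem hasCoresolution_gorensteinInjective (hR : EnoughFiniteInjectives R) {i : ℕ}
    {J : ModuleCat.{u} R}
    (hG : ∀ X : ModuleCat.{u} R, rightPerp (addClosure J) X → gorensteinInjective X)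
    {X : ModuleCat.{u} R} (hX : Module.Finite R X)
    (h : ∀ n, ExtZero.{u} J X (i + 1 + n)) : HasCoresolution gorensteinInjective i X := by
  induction i generalizing X with
  | zero =>
    refine ⟨X, hG X (rightPerp_addClosure_iff.2 ⟨hX, fun n => ?_⟩), ⟨Iso.refl X⟩⟩
    convert h n using 1
    omega
  | succ i ih =>
    obtain ⟨I, N, f, g, hs, hI, hIfin, hN⟩ := hR.exists_ses X hX
    refine ⟨I, N, f, g, hs.choose, hs.choose_spec, hG I (rightPerp_of_injective hI hIfin _),
      ih hN fun n => ?_⟩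
    rw [show i + 1 + n = i + n + 1 by omega]
    refine hs.extZero_right _ (.of_injective _ I _) ?_
    convert h n using 1
    omega

theorem HasCoresolution.extZero_of_leftPerp {T X : ModuleCat.{u} R}
    (hX : leftPerp (addClosure T) X) : ∀ {m : ℕ} {M : ModuleCat.{u} R},
      HasCoresolution (addClosure T) m M → ∀ n, ExtZero.{u} X M (m + 1 + n)
  | 0, _, ⟨_, hC, ⟨e⟩⟩, n => by
    rw [show 0 + 1 + n = n + 1 by omega]
    exact (hX.extZero hC n).retract_right (.ofIso e)
  | m + 1, _, ⟨_, _, _, _, w, hS, hC, hN⟩, n => by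
    rw [show m + 1 + 1 + n = m + 1 + n + 1 by omega]
    exact IsSES.extZero_left X ⟨w, hS⟩ (hN.extZero_of_leftPerp hX n) (hX.extZero hC _)

theorem HasResolution.extZero_of_rightPerp {T Y : ModuleCat.{u} R}
    (hY : rightPerp (addClosure T) Y) : ∀ {m : ℕ} {M : ModuleCat.{u} R},
      HasResolution (addClosure T) m M → ∀ n, ExtZero.{u} M Y (m + 1 + n)
  | 0, _, ⟨_, hC, ⟨e⟩⟩, n => by
    rw [show 0 + 1 + n = n + 1 by omega]
    exact (hY.extZero hC n).retract_left (.ofIso e.symm)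
  | m + 1, _, ⟨_, _, _, _, w, hS, hC, hN⟩, n => by
    rw [show m + 1 + 1 + n = m + 1 + n + 1 by omega]
    exact IsSES.zeroExt_right Y ⟨w, hS⟩ (hN.extZero_of_rightPerp hY n) (hY.extZero hC _)

theorem gorensteinProjectiveDimension_le_iff {M : ModuleCat.{u} R} {m : ℕ} :
    gorensteinProjectiveDimension M ≤ (m : ℕ∞) ↔
      ∃ k ≤ m, HasResolution gorensteinProjective k M := by
  refine ⟨fun h => ?_, fun ⟨k, hk, h⟩ =>
    le_trans (sInf_le ⟨k, rfl, h⟩) (Nat.cast_le.2 hk)⟩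
  have hne : {n : ℕ∞ | ∃ k : ℕ, n = (k : ℕ∞) ∧ HasResolution gorensteinProjective k M}.Nonempty := by
    by_contra hem
    rw [Set.not_nonempty_iff_eq_empty] at hem
    rw [gorensteinProjectiveDimension, hem, sInf_empty] at h
    exact absurd h (by simp)
  obtain ⟨k, hk, hres⟩ := csInf_mem hne
  exact ⟨k, Nat.cast_le.1 (le_trans hk.ge h), hres⟩

theorem gorensteinInjectiveDimension_le_iff {M : ModuleCat.{u} R} {m : ℕ} :
    gorensteinInjectiveDimension M ≤ (m : ℕ∞) ↔
      ∃ k ≤ m, HasCoresolution gorensteinInjective k M := by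
  refine ⟨fun h => ?_, fun ⟨k, hk, h⟩ =>
    le_trans (sInf_le ⟨k, rfl, h⟩) (Nat.cast_le.2 hk)⟩
  have hne : {n : ℕ∞ | ∃ k : ℕ, n = (k : ℕ∞) ∧ HasCoresolution gorensteinInjective k M}.Nonempty := by
    by_contra hem
    rw [Set.not_nonempty_iff_eq_empty] at hem
    rw [gorensteinInjectiveDimension, hem, sInf_empty] at h
    exact absurd h (by simp)
  obtain ⟨k, hk, hres⟩ := csInf_mem hne
  exact ⟨k, Nat.cast_le.1 (le_trans hk.ge h), hres⟩

end Gorenstein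

/-! ### The algebra and its opposite -/

section Main

variable (K A : Type u) [Field K] [Ring A] [Algebra K A]

/-- An algebra and its opposite. -/
def oppositePair : OppositePair K A Aᵐᵒᵖ where
  equiv := (opLinearEquiv K).symm
  map_one := rfl
  map_mul _ _ := rfl

variable {K A}

variable (K) in
/-- The injective cogenerator `D(A)` of the category of right modules. -/
abbrev cogenerator (A : Type u) [Ring A] [Algebra K A] : ModuleCat.{u} Aᵐᵒᵖ :=
  (oppositePair K A).dual (regular A)

theorem isCogenerator_cogenerator : IsCogenerator (cogenerator K A) :=
  OppositePair.isCogenerator_dual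

theorem injective_cogenerator : Injective (cogenerator K A) := OppositePair.injective_dual _

theorem IsCotilting.isCotiltingFor {T : ModuleCat.{u} Aᵐᵒᵖ} (hT : IsCotilting K T) :
    IsCotiltingFor (cogenerator K A) T :=
  ⟨hT.finite, fun n => hT.ext_self (n + 1) (by omega), isCogenerator_cogenerator, hT.resolution⟩

variable [Module.Finite K A]

theorem finite_cogenerator : Module.Finite Aᵐᵒᵖ (cogenerator K A) :=
  OppositePair.finite_dual _ finite_regular

theorem enoughFiniteInjectives_left (K A : Type u) [Field K] [Ring A] [Algebra K A]
    [Module.Finite K A] : EnoughFiniteInjectives A :=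
  have : Module.Finite K Aᵐᵒᵖ := Module.Finite.equiv (opLinearEquiv K)
  (OppositePair.isCogenerator_dual (p := (oppositePair K A).symm)).enoughFiniteInjectives K
    (OppositePair.injective_dual _) (OppositePair.finite_dual _ finite_regular)

end Main

end RepTheory

end

/-! ### The theorem: two circles of inclusions and two double perpendiculars -/

theorem mainTheorem8 {K A : Type u} [Field K] [Ring A] [Algebra K A] [Module.Finite K A]
    (r i : ℕ) (hA : RepTheory.IsAuslanderGorenstein A r) (hi : i ≤ r)
    (T : ModuleCat.{u} Aᵐᵒᵖ) (hT : RepTheory.IsTilting T) (hT' : RepTheory.IsCotilting K T)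
    (hbasic : RepTheory.IsBasic T)
    (hpd : projectiveDimension T = (i : WithBot ℕ∞))
    (hid : injectiveDimension T = ((r - i : ℕ) : WithBot ℕ∞)) :
    (RepTheory.leftPerp (RepTheory.addClosure T) = RepTheory.gprojLE i ∧
      RepTheory.gprojLE (R := Aᵐᵒᵖ) i = RepTheory.domGE (r - i)) ∧
    (RepTheory.finitelyCoresolved (RepTheory.addClosure T) =
        RepTheory.leftPerp (RepTheory.rightPerp (RepTheory.addClosure T)) ∧
      RepTheory.leftPerp (RepTheory.rightPerp (RepTheory.addClosure T)) = RepTheory.projLE i) ∧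
    (RepTheory.finitelyResolved (RepTheory.addClosure T) =
        RepTheory.rightPerp (RepTheory.leftPerp (RepTheory.addClosure T)) ∧
      RepTheory.rightPerp (RepTheory.leftPerp (RepTheory.addClosure T)) =
        RepTheory.injLE (r - i)) ∧
    (RepTheory.rightPerp (RepTheory.addClosure T) = RepTheory.ginjLE (r - i) ∧
      RepTheory.ginjLE (r - i) = RepTheory.codomGE K (A := A) i) := by
  open RepTheory in
  have hfinop : Module.Finite K Aᵐᵒᵖ := Module.Finite.equiv (opLinearEquiv K)
  have hart : IsArtinianRing A := IsArtinianRing.of_finite K A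
  have hart' : IsArtinianRing Aᵐᵒᵖ := IsArtinianRing.of_finite K Aᵐᵒᵖ
  have hL : EnoughFiniteInjectives A := enoughFiniteInjectives_left K A
  have hJc := isCogenerator_cogenerator (K := K) (A := A)
  have hJ := injective_cogenerator (K := K) (A := A)
  have hJfin := finite_cogenerator (K := K) (A := A)
  have hR : EnoughFiniteInjectives Aᵐᵒᵖ := hJc.enoughFiniteInjectives K hJ hJfin
  have hJres : HasResolution (addClosure (regular Aᵐᵒᵖ)) r (cogenerator K A) :=
    (hasCoresolution_of_injectiveDimension hL finite_regular
      hA.injectiveDimension_left.le).dual (oppositePair K A)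
  have hJadd := fun (I : ModuleCat.{u} Aᵐᵒᵖ) (hI : Injective I) (hIfin : Module.Finite Aᵐᵒᵖ I) =>
    hJc.addClosure_of_injective K hJfin hI hIfin
  have hAco : HasCoresolution (addClosure (cogenerator K A)) r (regular Aᵐᵒᵖ) :=
    (hasCoresolution_of_injectiveDimension hR finite_regular
      hA.injectiveDimension_right.le).mono fun I hI => hJadd I hI.1 hI.2
  have hdom : HasProjInjCopresentation r (regular Aᵐᵒᵖ) :=
    hasProjInjCopresentation_of_le_dominantDimension hR finite_regular hA.dominantDimension_eq.ge
  have hAcot : IsCotiltingFor (cogenerator K A) (regular Aᵐᵒᵖ) :=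
    ⟨finite_regular, fun n => .of_projective _ _ n, hJc, r, hJres⟩
  have hTc := hT'.isCotiltingFor
  have hpd' := projectiveDimension_le_iff_extZero.1 hpd.le
  have hid' := injectiveDimension_le_iff_extZero.1 hid.le
  have h1 : ∀ X, leftPerp (addClosure T) X → gprojLE i X := fun X hX => by
    refine ⟨hX.1, gorensteinProjectiveDimension_le_iff.2 ⟨i, le_rfl, ?_⟩⟩
    refine hasResolution_gorensteinProjective
      (fun X => gorensteinProjective_of_leftPerp K hAcot) hX.1 ?_
    -- The tilting axiom gives some coresolution of `A`; here its length is brought down to `i`, the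
    -- projective dimension of `T`.
    exact (hT.hasCoresolution K hR (leftPerp_of_projective projective_regular finite_regular _)
      (hpd' _)).extZero_of_leftPerp hX
  have h2 : ∀ X : ModuleCat.{u} Aᵐᵒᵖ, gprojLE i X → domGE (r - i) X := fun X hX => by
    obtain ⟨k, hk, hres⟩ := gorensteinProjectiveDimension_le_iff.1 hX.2
    exact ⟨hX.1, LeftTorsionExtZero.le_dominantDimension hR ⟨hX.1, fun Z hZ j hj =>
      hres.extZero_of_gorensteinProjective (fun j hj => hdom.extZero hZ j hj) j (by omega)⟩⟩
  have h3 : ∀ X, domGE (r - i) X → leftPerp (addClosure T) X := fun X hX => by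
    have hco := hasProjInjCopresentation_of_le_dominantDimension hR hX.1 hX.2
    refine leftPerp_addClosure_iff.2 ⟨hX.1, fun n =>
      hco.extZero_of_injectiveDimension fun Z => ?_⟩
    convert hid' Z n using 1
    omega
  have h4 : ∀ Y, rightPerp (addClosure T) Y → ginjLE (r - i) Y := fun Y hY => by
    refine ⟨hY.1, gorensteinInjectiveDimension_le_iff.2 ⟨r - i, le_rfl, ?_⟩⟩
    refine hasCoresolution_gorensteinInjective hR
      (fun X => gorensteinInjective_of_rightPerp K hJc hJ hJfin hAco) hY.1 ?_
    exact (hTc.hasResolution K (rightPerp_of_injective hJ hJfin _)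
      (hid' _)).extZero_of_rightPerp hY
  -- Kept separate from `h5` because `h7` uses the presentation itself. The degrees fit: `j < i` and
  -- `k ≤ r - i` give `j + k < r`.
  have h5' : ∀ Y : ModuleCat.{u} Aᵐᵒᵖ, ginjLE (r - i) Y → HasProjInjPresentation i Y :=
    fun Y hY => by
      obtain ⟨k, hk, hres⟩ := gorensteinInjectiveDimension_le_iff.1 hY.2
      exact hasProjInjPresentation_of_extZero hY.1 fun Z hZ j hj =>
        hres.extZero_of_gorensteinInjective hJadd (fun j hj =>
          extZero_cogenerator_of_isRightTorsion hJ hJfin hdom hA.injectiveDimension_right.le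
            hJres hZ hj) j (by omega)
  have h5 : ∀ Y : ModuleCat.{u} Aᵐᵒᵖ, ginjLE (r - i) Y → codomGE K i Y := fun Y hY => by
    have hco := (h5' Y hY).dual (oppositePair K A).symm
    exact ⟨hY.1, LeftTorsionExtZero.le_dominantDimension hL
      ⟨OppositePair.finite_dual (p := (oppositePair K A).symm) Y hY.1, fun Z hZ j hj => hco.extZero hZ j hj⟩⟩
  have h6 : ∀ Y, codomGE K i Y → rightPerp (addClosure T) Y := fun Y hY => by
    have hco := hasProjInjCopresentation_of_le_dominantDimension hL
      (OppositePair.finite_dual (p := (oppositePair K A).symm) Y hY.1) hY.2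
    have hpres := (hasProjInjCopresentation_dual_iff (oppositePair K A).symm hY.1).1 hco
    refine rightPerp_addClosure_iff.2 ⟨hY.1, fun n =>
      hpres.extZero_of_projectiveDimension fun Z => ?_⟩
    convert hpd' Z n using 1
    omega
  -- `Ext^{n+1}(M, Y)` shifts along the `i` projective-injective terms presenting `Y` to degree `n +
  -- 1 + i`, beyond the projective dimension of `M`.
  have h7 : ∀ M, projLE i M → leftPerp (rightPerp (addClosure T)) M := fun M hM => by
    refine leftPerp_of_extZero hM.1 fun Y hY n =>
      (h5' Y (h4 Y hY)).extZero_of_projectiveDimension fun Z => ?_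
    convert projectiveDimension_le_iff_extZero.1 hM.2 Z n using 1
    omega
  have h8 : ∀ M, injLE (r - i) M → rightPerp (leftPerp (addClosure T)) M := fun M hM => by
    refine rightPerp_of_extZero hM.1 fun X hX n =>
      (hasProjInjCopresentation_of_le_dominantDimension hR hX.1
        (h2 X (h1 X hX)).2).extZero_of_injectiveDimension fun Z => ?_
    convert injectiveDimension_le_iff_extZero.1 hM.2 Z n using 1
    omega
  refine ⟨⟨?_, ?_⟩, ⟨hT.finitelyCoresolved_eq K hR hpd.le, ?_⟩,
    ⟨hTc.finitelyResolved_eq K hid.le, ?_⟩, ?_, ?_⟩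
  · ext X
    exact ⟨h1 X, fun h => h3 X (h2 X h)⟩
  · ext X
    exact ⟨h2 X, fun h => h1 X (h3 X h)⟩
  · ext M
    exact ⟨fun h => ⟨h.1, leftPerp_rightPerp_projectiveDimension_le hR h hpd.le⟩, h7 M⟩
  · ext M
    exact ⟨fun h => ⟨h.1, rightPerp_leftPerp_injectiveDimension_le hR h hid.le⟩, h8 M⟩
  · ext Y
    exact ⟨h4 Y, fun h => h6 Y (h5 Y h)⟩
  · ext Y
    exact ⟨h5 Y, fun h => h4 Y (h6 Y h)⟩
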